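/- An instance of Label Cover consists of a bipartite graph $G=(A,B,E)$, finite alphabets $\Sigma_A,\Sigma_B$, and for every edge $e\in E$ a nonempty relation $\pi_e\subseteq\Sigma_A\times\Sigma_B$. Assignments $\gamma_A:A\to\Sigma_A$, $\gamma_B:B\to\Sigma_B$ satisfy the edge $e=(a,b)$ if $(\gamma_A(a),\gamma_B(b))\in\pi_e$. Write $n=|A|+|B|$, and let $\log$ be the logarithm to base $2$. The girth of $G$ is the length of its shortest cycle ($\infty$ if there is none). Instances are encoded explicitly (sizes of $A,B,\Sigma_A,\Sigma_B$ in unary, adjacency matrix, truth tables of the relations). A randomized polynomial-time algorithm distinguishes two classes of instances if it runs in time polynomial in the size of the encoding on every Label Cover instance and there are a constant $\varepsilon>0$ and an $N$ such that it accepts every instance of the first class with $n\ge N$ with probability at least $\frac12+\varepsilon$, and every instance of the second class with $n\ge N$ with probability at most $\frac12-\varepsilon$. Theorem. There is an absolute constant $c>0$ such that the following holds. Let $d,\sigma_A,\sigma_B,k:\mathbb N\to\mathbb N$ and $s,\alpha:\mathbb N\to\mathbb R$ be functions of $n$, where $k(n)$ can be computed in time polynomial in $n$ (with $n$ and $k(n)$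 in unary; for example, $k$ constant) and, for all sufficiently large $n$, $\sigma_A(n)\ge 2$, $\sigma_A(n)\ge\sigma_B(n)$ and $s(n)>0$. All instances below have $|A|=|B|=n/2$, $|\Sigma_A|=\sigma_A(n)$ and $|\Sigma_B|=\sigma_B(n)$. Suppose that no randomized polynomial-time algorithm distinguishes * the instances in which every vertex has degree $d(n)$ and all edges can be satisfied simultaneously, from * the instances in which every vertex has degree $d(n)$ and every pair of assignments satisfies at most an $s(n)$ fraction of the edges. Suppose further that, for all sufficiently large $n$, $$18\log n\ \le\ \alpha(n)\ \le\ \min\left\{\frac1{s(n)},\ \frac{d(n)^{1/k(n)}}{\log\sigma_A(n)}\right\}.$$ Then no randomized polynomial-time algorithm distinguishes * the instances with at least one edge and girth greater than $k(n)$ in which all edges can be satisfied simultaneously, from * the instances with at least one edge and girth greater than $k(n)$ in which every pair of assignments satisfies at most a $c/\alpha(n)$ fraction of the edges. -/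

import Mathlib

open Filter

/-! ### Label Cover -/

/-- An instance of Label Cover: a bipartite graph with sides `Fin nA` and `Fin nB` and edge set `E`,
alphabets `Fin qA` and `Fin qB`, and a nonempty relation `rel e` for every edge `e`.
(The value of `rel` outside `E` is irrelevant: no definition below reads it.) -/
structure LabelCover where
  nA : ℕ
  nB : ℕ
  qA : ℕ
  qB : ℕ
  E : Finset (Fin nA × Fin nB)
  rel : Fin nA × Fin nB → Finset (Fin qA × Fin qB)
  rel_nonempty : ∀ e ∈ E, (rel e).Nonempty

namespace LabelCover

/-- The number `n` of vertices of the graph. -/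
def numVertices (I : LabelCover) : ℕ := I.nA + I.nB

/-- The underlying bipartite graph. -/
def supergraph (I : LabelCover) : SimpleGraph (Fin I.nA ⊕ Fin I.nB) :=
  SimpleGraph.fromRel fun u v => ∃ a b, (a, b) ∈ I.E ∧ u = Sum.inl a ∧ v = Sum.inr b

/-- The set of edges satisfied by the assignments `γA` and `γB`. -/
def satisfied (I : LabelCover) (γA : Fin I.nA → Fin I.qA) (γB : Fin I.nB → Fin I.qB) :
    Finset (Fin I.nA × Fin I.nB) :=
  I.E.filter fun e => (γA e.1, γB e.2) ∈ I.rel e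

/-- All edges can be satisfied simultaneously. -/
def FullySatisfiable (I : LabelCover) : Prop :=
  ∃ γA γB, I.satisfied γA γB = I.E

/-- At most a `t` fraction of the edges can be satisfied simultaneously. -/
def ValueAtMost (I : LabelCover) (t : ℝ) : Prop :=
  ∀ γA γB, ((I.satisfied γA γB).card : ℝ) ≤ t * (I.E.card : ℝ)

/-- Every vertex has degree `d`. -/
def Regular (I : LabelCover) (d : ℕ) : Prop :=
  (∀ a, (I.E.filter fun e => e.1 = a).card = d) ∧ (∀ b, (I.E.filter fun e => e.2 = b).card = d)

/-- The two sides have the same size `n / 2`, and the alphabets have the sizes `σA n` and `σB n`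
prescribed for graphs with `n` vertices. -/
def Balanced (σA σB : ℕ → ℕ) (I : LabelCover) : Prop :=
  I.nA = I.nB ∧ I.qA = σA I.numVertices ∧ I.qB = σB I.numVertices

end LabelCover

/-! ### Randomized polynomial time

Programs of the while language over binary trees, with a fair coin. It has the same polynomial time
as multi-tape Turing machines: trees can be stored as pointer structures, and every step evaluates
one expression of the (fixed) program, creating a bounded number of new nodes. -/

/-- The data of the programs: binary trees. -/
inductive BinTree : Type
  | nil : BinTree
  | cons : BinTree → BinTree → BinTree

namespace BinTree

def hd : BinTree → BinTree
  | nil => nil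
  | cons a _ => a

def tl : BinTree → BinTree
  | nil => nil
  | cons _ b => b

/-- The number of nodes, leaves included. -/
def size : BinTree → ℕ
  | nil => 1
  | cons a b => size a + size b + 1

def ofList : List BinTree → BinTree
  | [] => nil
  | a :: l => cons a (ofList l)

/-- Numbers in unary. -/
def ofNat (n : ℕ) : BinTree := ofList (List.replicate n nil)

/-- The truth value false is `nil`, the truth value true is `cons nil nil`. -/
def ofBool (b : Bool) : BinTree := bif b then cons nil nil else nil

end BinTree

/-- Expressions; variables are numbered. -/
inductive TreeExpr : Type
  | nil : TreeExpr
  | var : ℕ → TreeExpr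
  | cons : TreeExpr → TreeExpr → TreeExpr
  | hd : TreeExpr → TreeExpr
  | tl : TreeExpr → TreeExpr

def TreeExpr.eval (s : ℕ → BinTree) : TreeExpr → BinTree
  | .nil => .nil
  | .var x => s x
  | .cons e f => .cons (e.eval s) (f.eval s)
  | .hd e => (e.eval s).hd
  | .tl e => (e.eval s).tl

/-- Programs. -/
inductive TreeProg : Type
  | assign : ℕ → TreeExpr → TreeProg
  | flip : ℕ → TreeProg
  | seq : TreeProg → TreeProg → TreeProg
  | ite : TreeExpr → TreeProg → TreeProg → TreeProg
  | loop : TreeExpr → TreeProg → TreeProg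

namespace TreeProg

/-- A configuration: the programs that remain to be executed, in this order, and the values of the
variables. The computation has halted when nothing remains to be executed. -/
abbrev Cfg : Type := List TreeProg × (ℕ → BinTree)

open Classical in
/-- One step of the computation; `flip x` sets `x` to a uniformly random truth value. -/
noncomputable def step : Cfg → PMF Cfg
  | ([], s) => PMF.pure ([], s)
  | (assign x e :: K, s) => PMF.pure (K, Function.update s x (e.eval s))
  | (flip x :: K, s) =>
      (PMF.uniformOfFintype Bool).map fun b => (K, Function.update s x (BinTree.ofBool b))
  | (seq P Q :: K, s) => PMF.pure (P :: Q :: K, s)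
  | (ite e P Q :: K, s) => PMF.pure (if e.eval s = .nil then (Q :: K, s) else (P :: K, s))
  | (loop e P :: K, s) =>
      PMF.pure (if e.eval s = .nil then (K, s) else (P :: loop e P :: K, s))

/-- The distribution of the configuration after `t` steps. -/
noncomputable def run : ℕ → Cfg → PMF Cfg
  | 0, c => PMF.pure c
  | t + 1, c => (step c).bind (run t)

/-- The initial configuration: the input is in variable `0`, all other variables are `nil`. -/
def init (P : TreeProg) (input : BinTree) : Cfg :=
  ([P], Function.update (fun _ => BinTree.nil) 0 input)

/-- On the given input, `P` halts within `t` steps, whatever the coin flips are. -/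
def HaltsWithin (P : TreeProg) (input : BinTree) (t : ℕ) : Prop :=
  ∀ c ∈ (run t (P.init input)).support, c.1 = []

/-- The probability that `P` accepts within `t` steps, that is, halts within `t` steps with a value
other than `nil` in variable `0`. -/
noncomputable def acceptProb (P : TreeProg) (input : BinTree) (t : ℕ) : ℝ :=
  ((run t (P.init input)).toOuterMeasure {c | c.1 = [] ∧ c.2 0 ≠ BinTree.nil}).toReal

end TreeProg

/-- The function `f` can be computed in time polynomial in its argument (argument and value are
given in unary; the value is left in variable `0`). -/
def PolyTimeComputable (f : ℕ → ℕ) : Prop :=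
  ∃ (P : TreeProg) (p : Polynomial ℕ), ∀ n : ℕ,
    ∀ c ∈ (TreeProg.run (p.eval n) (P.init (BinTree.ofNat n))).support,
      c.1 = [] ∧ c.2 0 = BinTree.ofNat (f n)

open Classical in
/-- The encoding of an instance as a tree: the sizes of the sides and of the alphabets in unary,
followed by the matrix that has, for every pair `(a, b)`, the entry `nil` if `(a, b)` is not an edge
and the truth table of the (nonempty) relation otherwise. -/
noncomputable def LabelCover.encode (I : LabelCover) : BinTree :=
  BinTree.ofList
    [ BinTree.ofNat I.nA, BinTree.ofNat I.nB, BinTree.ofNat I.qA, BinTree.ofNat I.qB,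
      BinTree.ofList ((List.finRange I.nA).map fun a =>
        BinTree.ofList ((List.finRange I.nB).map fun b =>
          if (a, b) ∈ I.E then
            BinTree.ofList ((List.finRange I.qA).map fun x =>
              BinTree.ofList ((List.finRange I.qB).map fun y =>
                BinTree.ofBool (decide ((x, y) ∈ I.rel (a, b)))))
          else BinTree.nil)) ]

/-- Some randomized polynomial-time algorithm distinguishes the instances in `yes` from the
instances in `no`: it runs, on every instance of Label Cover, in time polynomial in the size of the
instance, and its error probability is bounded away from `1 / 2` on all instances in `yes` and in
`no` with sufficiently many vertices. -/
def RandPolyTimeDistinguishable (yes no : LabelCover → Prop) : Prop :=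
  ∃ (P : TreeProg) (p : Polynomial ℕ) (ε : ℝ) (N : ℕ), 0 < ε ∧
    (∀ I : LabelCover, P.HaltsWithin I.encode (p.eval I.encode.size)) ∧
    ∀ I : LabelCover, N ≤ I.numVertices →
      (yes I → 1 / 2 + ε ≤ P.acceptProb I.encode (p.eval I.encode.size)) ∧
      (no I → P.acceptProb I.encode (p.eval I.encode.size) ≤ 1 / 2 - ε)

/-! ### Trees as lists -/

namespace BinTree

/-! The hard regular instances are sparsified at random. Every edge is kept independently with
probability p = 2^(-j), and then every kept edge that lies on a cycle of length at most k of kept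
edges is deleted. The girth exceeds k by construction, and a fully satisfiable instance stays so.
The number j (`coinCount`) makes the expected degree D = p d comparable to d^(1/k): D^k ≤ d
(`pow_density_le`) and d^(1/k) ≤ 4 D (`rpow_le_four_mul_density`).

Few edges are lost to short cycles. The ends of an edge are joined by at most d^l walks of length l
+ 1, and such a detour without repeated edges survives together with the edge with probability
p^(l+2). Summing (`avg_card_joined_le`) and using D^k ≤ d, one expects at most 2p|E|/D kept edges on
short cycles, against p|E| kept edges in all. So at least p|E|/8 edges remain, except with
probability 20/D (`prob_card_highGirth_le`), which is O(1/log n) because 18 log n ≤ α ≤ d^(1/k) ≤ 4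
D.

Soundness is a union bound over the at most σ_A^n pairs of assignments (`prob_exists_satisfied_le`).
Each satisfies at most |E|/α edges; with θ = p|E|/α, a Chernoff bound shows that 18θ or more of
these are kept with probability at most 2^(-16θ), while α log σ_A ≤ d^(1/k) ≤ 4 D bounds the number
of pairs by 2^(8θ). Dividing 18θ by p|E|/8 gives the fraction 144/α.

The remaining work is to carry out the reduction by a tree program (`exists_reduction`), by means of
a calculus of subroutines, `PolyTime` and `RandTime`. Only k has to be computed: d is read off the
matrix, and fair coins suffice since p is a power of 1/2. The new algorithm accepts with the average
over the coins of the old acceptance probabilities, so an advantage ε leaves at least ε/2 for large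
n. -/

def toList : BinTree → List BinTree
  | nil => []
  | cons a b => a :: toList b

@[simp] theorem toList_nil : nil.toList = [] := rfl

@[simp] theorem toList_cons (a b : BinTree) : (cons a b).toList = a :: b.toList := rfl

@[simp] theorem ofList_nil : ofList [] = nil := rfl

@[simp] theorem ofList_cons (a : BinTree) (l : List BinTree) :
    ofList (a :: l) = cons a (ofList l) := rfl

@[simp] theorem toList_ofList (l : List BinTree) : (ofList l).toList = l := by
  induction l <;> simp [*]

@[simp] theorem ofList_toList (t : BinTree) : ofList t.toList = t := by
  induction t with
  | nil => rfl
  | cons a b _ ih => simp [ih]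

@[simp] theorem hd_cons (a b : BinTree) : (cons a b).hd = a := rfl

@[simp] theorem tl_cons (a b : BinTree) : (cons a b).tl = b := rfl

@[simp] theorem hd_nil : nil.hd = nil := rfl

@[simp] theorem tl_nil : nil.tl = nil := rfl

@[simp] theorem size_nil : nil.size = 1 := rfl

@[simp] theorem size_cons (a b : BinTree) : (cons a b).size = a.size + b.size + 1 := rfl

theorem one_le_size (t : BinTree) : 1 ≤ t.size := by cases t <;> simp

theorem size_hd_le (t : BinTree) : t.hd.size ≤ t.size := by
  cases t <;> simp only [hd_nil, hd_cons, size_cons, le_refl]; omega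

theorem size_tl_le (t : BinTree) : t.tl.size ≤ t.size := by
  cases t <;> simp only [tl_nil, tl_cons, size_cons, le_refl]; omega

theorem size_le_of_mem_toList {e t : BinTree} (h : e ∈ t.toList) : e.size ≤ t.size := by
  induction t with
  | nil => simp at h
  | cons a b _ ih =>
    simp only [toList_cons, List.mem_cons] at h
    rcases h with rfl | h
    · simp only [size_cons]; omega
    · have := ih h; simp only [size_cons]; omega

theorem length_toList_le (t : BinTree) : t.toList.length ≤ t.size := by
  induction t with
  | nil => simp
  | cons a b _ ih => simp only [toList_cons, List.length_cons, size_cons]; omega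

@[simp] theorem toList_ofNat (n : ℕ) : (ofNat n).toList = List.replicate n nil := by
  simp [ofNat]

@[simp] theorem ofNat_zero : ofNat 0 = nil := rfl

@[simp] theorem ofNat_succ (n : ℕ) : ofNat (n + 1) = cons nil (ofNat n) := rfl

theorem size_ofNat (n : ℕ) : (ofNat n).size = 2 * n + 1 := by
  induction n with
  | zero => rfl
  | succ n ih => simp only [ofNat_succ, size_cons, size_nil, ih]; omega

theorem size_ofList_le (l : List BinTree) (B : ℕ) (h : ∀ e ∈ l, e.size ≤ B) :
    (ofList l).size ≤ l.length * (B + 1) + 1 := by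
  induction l with
  | nil => simp
  | cons a l ih =>
    have h1 := h a (by simp)
    have h2 := ih fun e he => h e (by simp [he])
    simp only [ofList_cons, size_cons, List.length_cons]
    rw [add_mul]
    omega

/-- Case distinction on whether a tree is `nil`. -/
def sel : BinTree → BinTree → BinTree → BinTree
  | nil, _, b => b
  | cons _ _, a, _ => a

@[simp] theorem sel_nil (a b : BinTree) : sel nil a b = b := rfl

@[simp] theorem sel_cons (c d a b : BinTree) : sel (cons c d) a b = a := rfl

theorem ofBool_true : ofBool true = cons nil nil := rfl

theorem ofBool_false : ofBool false = nil := rfl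

@[simp] theorem sel_ofBool (b : Bool) (x y : BinTree) :
    sel (ofBool b) x y = if b = true then x else y := by
  cases b <;> rfl

theorem size_ofBool_le (b : Bool) : (ofBool b).size ≤ 3 := by
  cases b <;> simp [ofBool_true, ofBool_false]

end BinTree

theorem Polynomial.eval_le_eval_nat (q : Polynomial ℕ) {m n : ℕ} (h : m ≤ n) :
    q.eval m ≤ q.eval n := by
  simp only [Polynomial.eval_eq_sum, Polynomial.sum]
  gcongr

/-! ### Execution in an exact number of steps -/

namespace TreeProg

/-- From the configuration `c`, the computation surely reaches `c'` after exactly `t` steps. -/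
def Reaches (c : Cfg) (t : ℕ) (c' : Cfg) : Prop := ∀ N, run (t + N) c = run N c'

theorem Reaches.trans {c c' c'' : Cfg} {t t' : ℕ} (h : Reaches c t c') (h' : Reaches c' t' c'') :
    Reaches c (t + t') c'' := fun N => by rw [add_assoc, h, h']

theorem reaches_of_step {c c' : Cfg} (h : step c = PMF.pure c') : Reaches c 1 c' := fun N => by
  rw [add_comm, run, h, PMF.pure_bind]

/-- The program `P`, started with the values `s`, ends with the values `s'` after exactly `t` steps. -/
def ExecIn (P : TreeProg) (s : ℕ → BinTree) (t : ℕ) (s' : ℕ → BinTree) : Prop :=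
  ∀ K, Reaches (P :: K, s) t (K, s')

theorem execIn_assign {x : ℕ} {e : TreeExpr} {s s' : ℕ → BinTree}
    (h : Function.update s x (e.eval s) = s') : ExecIn (assign x e) s 1 s' :=
  fun _ => reaches_of_step (by rw [step, h])

theorem ExecIn.seq {P Q : TreeProg} {s s' s'' : ℕ → BinTree} {t t' : ℕ} (h : ExecIn P s t s')
    (h' : ExecIn Q s' t' s'') : ExecIn (seq P Q) s (1 + (t + t')) s'' := fun K =>
  (reaches_of_step (by rw [step])).trans ((h (Q :: K)).trans (h' K))

theorem execIn_ite_nil {e : TreeExpr} {P Q : TreeProg} {s s' : ℕ → BinTree} {t : ℕ}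
    (he : e.eval s = .nil) (h : ExecIn Q s t s') : ExecIn (ite e P Q) s (1 + t) s' := fun K =>
  (reaches_of_step (by rw [step, if_pos he])).trans (h K)

theorem execIn_ite_ne_nil {e : TreeExpr} {P Q : TreeProg} {s s' : ℕ → BinTree} {t : ℕ}
    (he : e.eval s ≠ .nil) (h : ExecIn P s t s') : ExecIn (ite e P Q) s (1 + t) s' := fun K =>
  (reaches_of_step (by rw [step, if_neg he])).trans (h K)

theorem execIn_loop_nil {e : TreeExpr} {P : TreeProg} {s : ℕ → BinTree}
    (he : e.eval s = .nil) : ExecIn (loop e P) s 1 s := fun K =>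
  reaches_of_step (by rw [step, if_pos he])

theorem execIn_loop_ne_nil {e : TreeExpr} {P : TreeProg} {s s' s'' : ℕ → BinTree} {t t' : ℕ}
    (he : e.eval s ≠ .nil) (h : ExecIn P s t s') (h' : ExecIn (loop e P) s' t' s'') :
    ExecIn (loop e P) s (1 + (t + t')) s'' := fun K =>
  (reaches_of_step (by rw [step, if_neg he])).trans ((h (loop e P :: K)).trans (h' K))

/-- The values of the variables when only the variables `0`, `1` and `2` are in use. -/
def vals (x S z : BinTree) : ℕ → BinTree
  | 0 => x
  | 1 => S
  | 2 => z
  | _ => .nil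

@[simp] theorem vals_zero (x S z : BinTree) : vals x S z 0 = x := rfl

@[simp] theorem vals_one (x S z : BinTree) : vals x S z 1 = S := rfl

@[simp] theorem vals_two (x S z : BinTree) : vals x S z 2 = z := rfl

@[simp] theorem update_vals_zero (x S z y : BinTree) :
    Function.update (vals x S z) 0 y = vals y S z := by
  funext i; rcases i with _ | _ | _ | i <;> simp [Function.update, vals]

@[simp] theorem update_vals_one (x S z y : BinTree) :
    Function.update (vals x S z) 1 y = vals x y z := by
  funext i; rcases i with _ | _ | _ | i <;> simp [Function.update, vals]

@[simp] theorem update_vals_two (x S z y : BinTree) :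
    Function.update (vals x S z) 2 y = vals x S y := by
  funext i; rcases i with _ | _ | _ | i <;> simp [Function.update, vals]

theorem init_eq (P : TreeProg) (x : BinTree) : P.init x = ([P], vals x .nil .nil) := by
  rw [init]
  congr 1
  funext i; rcases i with _ | _ | _ | i <;> simp [Function.update, vals]

/-- The values of the variables between subroutines: an argument and a stack. -/
abbrev st (x S : BinTree) : ℕ → BinTree := vals x S .nil

end TreeProg

open TreeProg

attribute [simp] TreeExpr.eval

/-! ### Functions computable in polynomial time -/

/-- The function `f` can be computed in polynomial time by a subroutine that preserves the stack,
and the size of its values is polynomially bounded. -/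
def PolyTime (f : BinTree → BinTree) : Prop :=
  ∃ (P : TreeProg) (q : Polynomial ℕ), ∀ x, (f x).size ≤ q.eval x.size ∧
    ∃ t ≤ q.eval x.size, ∀ S, ExecIn P (st x S) t (st (f x) S)

namespace PolyTime

theorem of_assign {f : BinTree → BinTree} (e : TreeExpr) (he : ∀ x S, e.eval (st x S) = f x)
    (c : ℕ) (hf : ∀ x, (f x).size ≤ x.size + c) : PolyTime f := by
  refine ⟨.assign 0 e, .X + .C (c + 1), fun x => ⟨?_, 1, ?_, fun S => execIn_assign ?_⟩⟩
  · have := hf x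
    simp only [Polynomial.eval_add, Polynomial.eval_X, Polynomial.eval_C]; omega
  · simp only [Polynomial.eval_add, Polynomial.eval_X, Polynomial.eval_C]; omega
  · simp [he]

theorem id : PolyTime fun x => x := of_assign (.var 0) (by simp) 0 (by simp)

theorem nil : PolyTime fun _ => .nil :=
  of_assign .nil (by simp) 0 fun x => by simpa using x.one_le_size

theorem hd : PolyTime BinTree.hd :=
  of_assign (.hd (.var 0)) (by simp) 0 fun x => by simpa using x.size_hd_le

theorem tl : PolyTime BinTree.tl :=
  of_assign (.tl (.var 0)) (by simp) 0 fun x => by simpa using x.size_tl_le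

/-- The size bound for `f x` is what makes the time of the second subroutine polynomial in the size
of `x`; this is why `PolyTime` records it. -/
theorem comp {f g : BinTree → BinTree} (hg : PolyTime g) (hf : PolyTime f) :
    PolyTime fun x => g (f x) := by
  obtain ⟨P, q, hP⟩ := hf
  obtain ⟨Q, r, hQ⟩ := hg
  refine ⟨.seq P Q, q + r.comp q + 1, fun x => ?_⟩
  obtain ⟨h1, t, ht, h2⟩ := hP x
  obtain ⟨h3, u, hu, h4⟩ := hQ (f x)
  have h5 := r.eval_le_eval_nat h1
  simp only [Polynomial.eval_add, Polynomial.eval_comp, Polynomial.eval_one]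
  exact ⟨by omega, 1 + (t + u), by omega, fun S => (h2 S).seq (h4 S)⟩

theorem hd' {f : BinTree → BinTree} (hf : PolyTime f) : PolyTime fun x => (f x).hd := hd.comp hf

theorem tl' {f : BinTree → BinTree} (hf : PolyTime f) : PolyTime fun x => (f x).tl := tl.comp hf

/-- The stack first holds the argument while `f` is evaluated, then the value of `f` while `g` is
evaluated. -/
theorem cons {f g : BinTree → BinTree} (hf : PolyTime f) (hg : PolyTime g) :
    PolyTime fun x => .cons (f x) (g x) := by
  obtain ⟨P, q, hP⟩ := hf
  obtain ⟨Q, r, hQ⟩ := hg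
  refine ⟨.seq (.assign 1 (.cons (.var 0) (.var 1))) <| .seq P <|
    .seq (.assign 2 (.var 0)) <| .seq (.assign 0 (.hd (.var 1))) <|
    .seq (.assign 1 (.cons (.var 2) (.tl (.var 1)))) <| .seq (.assign 2 .nil) <| .seq Q <|
    .seq (.assign 0 (.cons (.hd (.var 1)) (.var 0))) (.assign 1 (.tl (.var 1))), q + r + 100,
    fun x => ?_⟩
  obtain ⟨h1, t, ht, h2⟩ := hP x
  obtain ⟨h3, u, hu, h4⟩ := hQ x
  have h5 : (100 : Polynomial ℕ).eval x.size = 100 := Polynomial.eval_ofNat ..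
  simp only [Polynomial.eval_add, BinTree.size_cons, h5]
  refine ⟨by omega, _, ?_, fun S => (execIn_assign (by simp; rfl)).seq <| (h2 _).seq <|
    (execIn_assign (by simp; rfl)).seq <| (execIn_assign (by simp; rfl)).seq <|
    (execIn_assign (by simp; rfl)).seq <| (execIn_assign (by simp; rfl)).seq <| (h4 _).seq <|
    (execIn_assign (by simp; rfl)).seq (execIn_assign (by simp))⟩
  omega

theorem sel {c f g : BinTree → BinTree} (hc : PolyTime c) (hf : PolyTime f) (hg : PolyTime g) :
    PolyTime fun x => .sel (c x) (f x) (g x) := by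
  obtain ⟨P, q, hP⟩ := hf
  obtain ⟨Q, r, hQ⟩ := hg
  obtain ⟨R, o, hR⟩ := hc
  refine ⟨.seq (.assign 1 (.cons (.var 0) (.var 1))) <| .seq R <|
    .seq (.assign 2 (.var 0)) <| .seq (.assign 0 (.hd (.var 1))) <|
    .seq (.assign 1 (.tl (.var 1))) <|
    .ite (.var 2) (.seq (.assign 2 .nil) P) (.seq (.assign 2 .nil) Q), q + r + o + 100,
    fun x => ?_⟩
  obtain ⟨h1, t, ht, h2⟩ := hP x
  obtain ⟨h3, u, hu, h4⟩ := hQ x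
  obtain ⟨h6, v, hv, h7⟩ := hR x
  have h5 : (100 : Polynomial ℕ).eval x.size = 100 := Polynomial.eval_ofNat ..
  simp only [Polynomial.eval_add, h5]
  cases hcx : c x with
  | nil =>
    rw [hcx] at h7
    refine ⟨by simp only [BinTree.sel_nil]; omega, _, ?_, fun S =>
      (execIn_assign (by simp; rfl)).seq <| (h7 _).seq <|
      (execIn_assign (by simp; rfl)).seq <| (execIn_assign (by simp; rfl)).seq <|
      (execIn_assign (by simp; rfl)).seq <| execIn_ite_nil (by simp) <|
      (execIn_assign (by simp)).seq (h4 S)⟩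
    omega
  | cons a b =>
    rw [hcx] at h7
    refine ⟨by simp only [BinTree.sel_cons]; omega, _, ?_, fun S =>
      (execIn_assign (by simp; rfl)).seq <| (h7 _).seq <|
      (execIn_assign (by simp; rfl)).seq <| (execIn_assign (by simp; rfl)).seq <|
      (execIn_assign (by simp; rfl)).seq <| execIn_ite_ne_nil (by simp) <|
      (execIn_assign (by simp)).seq (h2 S)⟩
    omega

/-- The body of a loop over the list `hd (var 0)`, whose accumulator is `hd (tl (var 0))`. -/
def foldBody (P : TreeProg) : TreeProg :=
  .seq (.assign 1 (.cons (.var 0) (.var 1))) <|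
  .seq (.assign 0 (.cons (.hd (.hd (.var 0))) (.tl (.var 0)))) <| .seq P <|
  .seq (.assign 0 (.cons (.tl (.hd (.hd (.var 1)))) (.cons (.var 0) (.tl (.tl (.hd (.var 1)))))))
    (.assign 1 (.tl (.var 1)))

/-- Only accumulators that really occur, after a prefix of the list, have to respect the size bound
`B`; this makes every pass through the body cost at most `T + 10` steps. -/
theorem execIn_fold {f : BinTree → BinTree} {P : TreeProg} {B T : ℕ} {env : BinTree}
    (hP : ∀ x : BinTree, x.size ≤ B → ∃ t ≤ T, ∀ S, ExecIn P (st x S) t (st (f x) S)) :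
    ∀ (l : List BinTree) (acc : BinTree),
    (∀ l' e, l' ++ [e] <+: l → (BinTree.cons e (.cons
      (l'.foldl (fun acc e => f (.cons e (.cons acc env))) acc) env)).size ≤ B) →
    ∃ t ≤ l.length * (T + 10) + 1, ∀ S, ExecIn (.loop (.hd (.var 0)) (foldBody P))
      (st (.cons (.ofList l) (.cons acc env)) S) t
      (st (.cons .nil (.cons (l.foldl (fun acc e => f (.cons e (.cons acc env))) acc) env)) S) := by
  intro l
  induction l with
  | nil => exact fun acc _ => ⟨1, by omega, fun S => execIn_loop_nil (by simp)⟩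
  | cons e l ih =>
    intro acc h
    obtain ⟨t, ht, h1⟩ := hP _ (h [] e (by simp))
    obtain ⟨u, hu, h2⟩ := ih (f (.cons e (.cons acc env))) fun l' e' he' => by
      simpa using h (e :: l') e' (by simpa using he')
    refine ⟨_, ?_, fun S => execIn_loop_ne_nil (by simp)
      ((execIn_assign (by simp; rfl)).seq <| (execIn_assign (by simp; rfl)).seq <|
      (h1 _).seq <| (execIn_assign (by simp; rfl)).seq (execIn_assign (by simp))) (h2 S)⟩
    simp only [List.length_cons, add_mul] at hu ⊢
    omega

/-- Repeating a polynomial-time step may blow up the data (squaring in every pass, say), hence the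
hypothesis that all intermediate accumulators stay polynomially bounded. The body gets element,
accumulator and environment packed into one tree. -/
theorem foldl {F : BinTree → BinTree → BinTree → BinTree} {l a : BinTree → BinTree}
    (hF : PolyTime fun y => F y.tl.tl y.tl.hd y.hd) (hl : PolyTime l) (ha : PolyTime a)
    (hs : ∃ q : Polynomial ℕ, ∀ x l', l' <+: (l x).toList →
      (l'.foldl (F x) (a x)).size ≤ q.eval x.size) :
    PolyTime fun x => (l x).toList.foldl (F x) (a x) := by
  obtain ⟨P, q, hP⟩ := hF
  obtain ⟨r, hr⟩ := hs
  have key : ∃ (Q : TreeProg) (o : Polynomial ℕ), ∀ x,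
      ∃ t ≤ o.eval x.size, ∀ S, ExecIn Q (st x S) t
        (st (.cons .nil (.cons ((l x).toList.foldl (F x) (a x)) x)) S) := by
    obtain ⟨R, p, hR⟩ := hl.cons (ha.cons id)
    refine ⟨.seq R (.loop (.hd (.var 0)) (foldBody P)),
      p + p * (q.comp (p + r + .X + 2) + 10) + 2, fun x => ?_⟩
    obtain ⟨h1, t, ht, h2⟩ := hR x
    obtain ⟨u, hu, h3⟩ := execIn_fold (f := fun y => F y.tl.tl y.tl.hd y.hd) (P := P)
      (B := (p + r + .X + 2).eval x.size) (T := (q.comp (p + r + .X + 2)).eval x.size)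
      (env := x) (fun y hy => by
        obtain ⟨-, t, ht, h⟩ := hP y
        exact ⟨t, ht.trans (by rw [Polynomial.eval_comp]; exact q.eval_le_eval_nat hy), h⟩)
      (l x).toList (a x) (fun l' e hle => by
        have hel : e ∈ (l x).toList := hle.subset (by simp)
        have h4 := BinTree.size_le_of_mem_toList hel
        have h5 := hr x l' ((List.prefix_append l' [e]).trans hle)
        simp only [BinTree.size_cons] at h1
        simp only [BinTree.size_cons, BinTree.hd_cons, BinTree.tl_cons, Polynomial.eval_add,
          Polynomial.eval_X, Polynomial.eval_ofNat]
        change (List.foldl (fun acc e => F x acc e) (a x) l').size ≤ _ at h5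
        omega)
    refine ⟨_, ?_, fun S => (h2 S).seq (by simpa using h3 S)⟩
    have h6 : (l x).toList.length ≤ p.eval x.size := by
      have := (l x).length_toList_le
      simp only [BinTree.size_cons] at h1
      omega
    have h7 := Nat.mul_le_mul_right ((q.comp (p + r + .X + 2)).eval x.size + 10) h6
    rw [Polynomial.eval_add, Polynomial.eval_add, Polynomial.eval_mul, Polynomial.eval_add,
      Polynomial.eval_ofNat, Polynomial.eval_ofNat]
    omega
  obtain ⟨Q, o, hQ⟩ := key
  refine ⟨.seq Q (.assign 0 (.hd (.tl (.var 0)))), o + r + 2, fun x => ⟨?_, ?_⟩⟩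
  · have := hr x _ (List.prefix_refl _)
    simp only [Polynomial.eval_add]; omega
  · obtain ⟨t, ht, h⟩ := hQ x
    refine ⟨_, ?_, fun S => (h S).seq (execIn_assign (by simp))⟩
    simp only [Polynomial.eval_add, Polynomial.eval_ofNat]; omega

/-- The growth per pass may depend on `x` but not on the accumulator, so it adds up to at most the
length of the list times the growth. -/
theorem foldl_of_growth {F : BinTree → BinTree → BinTree → BinTree} {l a : BinTree → BinTree}
    (hF : PolyTime fun y => F y.tl.tl y.tl.hd y.hd) (hl : PolyTime l) (ha : PolyTime a)
    (hs : ∃ q : Polynomial ℕ, ∀ x acc, ∀ e ∈ (l x).toList,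
      (F x acc e).size ≤ acc.size + q.eval x.size) :
    PolyTime fun x => (l x).toList.foldl (F x) (a x) := by
  refine foldl hF hl ha ?_
  obtain ⟨q, hq⟩ := hs
  obtain ⟨_, r, hr⟩ := ha
  obtain ⟨_, o, ho⟩ := hl
  refine ⟨r + o * q, fun x l' hl' => ?_⟩
  have key : ∀ (l' : List BinTree) (acc : BinTree), (∀ e ∈ l', e ∈ (l x).toList) →
      (l'.foldl (F x) acc).size ≤ acc.size + l'.length * q.eval x.size := by
    intro l'
    induction l' with
    | nil => simp
    | cons e l' ih =>
      intro acc h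
      have h1 := hq x acc e (h e (by simp))
      have h2 := ih (F x acc e) fun e' he' => h e' (by simp [he'])
      simp only [List.foldl_cons, List.length_cons, add_mul]
      omega
  have h1 := key l' (a x) fun e he => hl'.subset he
  have h2 : l'.length ≤ o.eval x.size :=
    hl'.length_le.trans ((l x).length_toList_le.trans (ho x).1)
  have h3 := Nat.mul_le_mul_right (q.eval x.size) h2
  have h4 := (hr x).1
  simp only [Polynomial.eval_add, Polynomial.eval_mul]
  omega

end PolyTime

/-! ### Operations on lists, numbers and truth values -/

namespace BinTree

/-- The truth value represented by a tree. -/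
def toBool : BinTree → Bool
  | nil => false
  | cons _ _ => true

@[simp] theorem toBool_nil : toBool nil = false := rfl

@[simp] theorem toBool_cons (a b : BinTree) : toBool (cons a b) = true := rfl

@[simp] theorem toBool_ofBool (b : Bool) : toBool (ofBool b) = b := by cases b <;> rfl

/-- The number that a tree, read as a list, represents in unary. -/
def len (t : BinTree) : ℕ := t.toList.length

@[simp] theorem len_ofNat (n : ℕ) : (ofNat n).len = n := by simp [len]

@[simp] theorem len_nil : nil.len = 0 := rfl

@[simp] theorem len_cons (a b : BinTree) : (cons a b).len = b.len + 1 := rfl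

theorem len_le_size (t : BinTree) : t.len ≤ t.size := t.length_toList_le

/-- The entry with number `len i` of a list. -/
def get (t i : BinTree) : BinTree := (tl^[i.len] t).hd

theorem iterate_tl_ofList (i : ℕ) (l : List BinTree) : tl^[i] (ofList l) = ofList (l.drop i) := by
  induction i generalizing l with
  | zero => rfl
  | succ i ih =>
    cases l with
    | nil => simpa using ih []
    | cons a l => simpa using ih l

@[simp] theorem iterate_tl_ofNat (i n : ℕ) : tl^[i] (ofNat n) = ofNat (n - i) := by
  rw [ofNat, iterate_tl_ofList, List.drop_replicate, ofNat]

@[simp] theorem get_table {n : ℕ} (f : Fin n → BinTree) (i : Fin n) :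
    get (ofList ((List.finRange n).map f)) (ofNat i) = f i := by
  rw [get, len_ofNat, iterate_tl_ofList, ← List.map_drop,
    List.drop_eq_getElem_cons (by simp)]
  simp

/-- The table of the values of `F` at the numbers less than `n`. -/
def tab (n : ℕ) (F : BinTree → BinTree) : BinTree :=
  ofList ((List.finRange n).map fun i : Fin n => F (ofNat i))

theorem tab_eq {n : ℕ} {F : BinTree → BinTree} {f : Fin n → BinTree} (h : ∀ i : Fin n,
    F (ofNat i) = f i) : tab n F = ofList ((List.finRange n).map f) := by
  simp only [tab, h]

theorem size_tab_le {n B : ℕ} {F : BinTree → BinTree} (h : ∀ e, (F e).size ≤ B) :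
    (tab n F).size ≤ n * (B + 1) + 1 := by
  have := size_ofList_le ((List.finRange n).map fun i : Fin n => F (ofNat i)) B (by simp [h])
  simpa [tab] using this

/-- Whether `p` holds for some number less than `n`. -/
def ex (n : ℕ) (p : BinTree → Bool) : Bool := decide (∃ i : Fin n, p (ofNat i) = true)

theorem toBool_ofNat (n : ℕ) : (ofNat n).toBool = decide (n ≠ 0) := by cases n <;> simp

def natEq (a b : BinTree) : Bool := !(tl^[a.len] b).toBool && !(tl^[b.len] a).toBool

@[simp] theorem natEq_ofNat (i j : ℕ) : natEq (ofNat i) (ofNat j) = decide (i = j) := by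
  simp only [natEq, len_ofNat, iterate_tl_ofNat, toBool_ofNat]
  by_cases h : i = j
  · simp [h]
  · have : j - i ≠ 0 ∨ i - j ≠ 0 := by omega
    simp only [h, decide_false, Bool.and_eq_false_iff, Bool.not_eq_false', decide_eq_true_eq]
    exact this

/-- One half, rounded down. -/
def half (t : BinTree) : BinTree :=
  (t.toList.foldl (fun acc _ => sel acc.hd (cons nil (cons nil acc.tl)) (cons (cons nil nil) acc.tl))
    nil).tl

/-- The head of the accumulator is the parity of the number counted so far, its tail the half
rounded down; the initial `nil` reads as zero in both places. -/
theorem half_fold (n : ℕ) : (List.replicate n nil).foldl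
    (fun acc _ => sel acc.hd (cons nil (cons nil acc.tl)) (cons (cons nil nil) acc.tl))
    nil = if n = 0 then nil else cons (ofBool (n % 2 = 1)) (ofNat (n / 2)) := by
  induction n with
  | zero => rfl
  | succ n ih =>
    rw [List.replicate_succ', List.foldl_append, ih]
    rcases Nat.eq_zero_or_pos n with rfl | hn
    · rfl
    rcases Nat.mod_two_eq_zero_or_one n with h | h
    · have h1 : (n + 1) % 2 = 1 := by omega
      have h2 : (n + 1) / 2 = n / 2 := by omega
      simp [h, h1, h2, hn.ne', ofBool_true]
    · have h1 : (n + 1) % 2 = 0 := by omega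
      have h2 : (n + 1) / 2 = n / 2 + 1 := by omega
      simp [h, h1, h2, hn.ne', ofBool_false]

theorem half_eq (t : BinTree) : half t = ofNat (t.len / 2) := by
  have key : ∀ l : List BinTree, ∀ a, l.foldl
      (fun acc _ => sel acc.hd (cons nil (cons nil acc.tl)) (cons (cons nil nil) acc.tl)) a =
      (List.replicate l.length nil).foldl
      (fun acc _ => sel acc.hd (cons nil (cons nil acc.tl)) (cons (cons nil nil) acc.tl)) a := by
    intro l
    induction l with
    | nil => simp
    | cons e l ih => intro a; exact ih _
  rw [half, key, half_fold, len]
  rcases Nat.eq_zero_or_pos t.toList.length with h | h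
  · rw [h]; rfl
  · simp [h.ne']

theorem half_ofNat (n : ℕ) : half (ofNat n) = ofNat (n / 2) := by
  rw [half_eq, len_ofNat]

theorem iterate_half_ofNat (t n : ℕ) : half^[t] (ofNat n) = ofNat (n / 2 ^ t) := by
  induction t generalizing n with
  | zero => simp
  | succ t ih => rw [Function.iterate_succ_apply, half_ofNat, ih, Nat.div_div_eq_div_mul, pow_succ']

end BinTree

namespace PolyTime

open BinTree

theorem tru : PolyTime fun _ => ofBool true := nil.cons nil

theorem toBool {f : BinTree → BinTree} (hf : PolyTime f) :
    PolyTime fun x => ofBool (f x).toBool := by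
  convert hf.sel tru nil with x
  cases f x <;> rfl

theorem ite {p : BinTree → Bool} {f g : BinTree → BinTree} (hp : PolyTime fun x => ofBool (p x))
    (hf : PolyTime f) (hg : PolyTime g) : PolyTime fun x => if p x = true then f x else g x := by
  convert hp.sel hf hg with x
  simp

theorem not {p : BinTree → Bool} (hp : PolyTime fun x => ofBool (p x)) :
    PolyTime fun x => ofBool (!p x) := by
  convert hp.sel nil tru with x
  cases p x <;> rfl

theorem and {p q : BinTree → Bool} (hp : PolyTime fun x => ofBool (p x))
    (hq : PolyTime fun x => ofBool (q x)) : PolyTime fun x => ofBool (p x && q x) := by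
  convert hp.sel hq nil with x
  cases p x <;> simp [ofBool_false]

theorem or {p q : BinTree → Bool} (hp : PolyTime fun x => ofBool (p x))
    (hq : PolyTime fun x => ofBool (q x)) : PolyTime fun x => ofBool (p x || q x) := by
  convert hp.sel tru hq with x
  cases p x <;> simp [ofBool_true]

/-- A fold that ignores the elements of the list: any list serves as a unary counter. -/
theorem iterate {F : BinTree → BinTree → BinTree} {c a : BinTree → BinTree}
    (hF : PolyTime fun y => F y.tl y.hd) (hc : PolyTime c) (ha : PolyTime a)
    (hs : ∃ q : Polynomial ℕ, ∀ x, ∀ m ≤ (c x).len, ((F x)^[m] (a x)).size ≤ q.eval x.size) :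
    PolyTime fun x => (F x)^[(c x).len] (a x) := by
  have key : ∀ x (l : List BinTree) a, l.foldl (fun acc _ => F x acc) a = (F x)^[l.length] a := by
    intro x l
    induction l with
    | nil => simp
    | cons e l ih => intro a; simp [ih]
  convert foldl (F := fun x acc _ => F x acc) (l := c) (a := a) ?_ hc ha ?_ with x
  · rw [key]; rfl
  · simpa using hF.comp (f := fun y => .cons y.tl.hd y.tl.tl) (id.tl'.hd'.cons id.tl'.tl')
  · obtain ⟨q, hq⟩ := hs
    exact ⟨q, fun x l' hl' => by rw [key]; exact hq x _ hl'.length_le⟩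

theorem iterate_tl {f c : BinTree → BinTree} (hf : PolyTime f) (hc : PolyTime c) :
    PolyTime fun x => BinTree.tl^[(c x).len] (f x) := by
  refine iterate (F := fun _ => BinTree.tl) id.hd'.tl' hc hf ?_
  obtain ⟨_, q, hq⟩ := hf
  refine ⟨q, fun x m _ => ?_⟩
  induction m with
  | zero => exact (hq x).1
  | succ m ih =>
    rw [Function.iterate_succ_apply']
    exact (size_tl_le _).trans (ih (by omega))

theorem get {f c : BinTree → BinTree} (hf : PolyTime f) (hc : PolyTime c) :
    PolyTime fun x => (f x).get (c x) := (iterate_tl hf hc).hd'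

theorem natEq {f g : BinTree → BinTree} (hf : PolyTime f) (hg : PolyTime g) :
    PolyTime fun x => ofBool (BinTree.natEq (f x) (g x)) :=
  (iterate_tl hg hf).toBool.not.and (iterate_tl hf hg).toBool.not

theorem half : PolyTime BinTree.half := by
  refine (foldl_of_growth (F := fun _ acc _ =>
    .sel acc.hd (.cons .nil (.cons .nil acc.tl)) (.cons (.cons .nil .nil) acc.tl)) ?_ id nil
    ⟨20, fun x acc e _ => ?_⟩).tl'
  · exact id.tl'.hd'.hd'.sel (nil.cons (nil.cons id.tl'.hd'.tl'))
      ((nil.cons nil).cons id.tl'.hd'.tl')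
  · have := acc.size_tl_le
    rw [Polynomial.eval_ofNat]
    cases acc.hd <;> simp <;> omega

theorem reverse {l : BinTree → BinTree} (hl : PolyTime l) :
    PolyTime fun x => ofList (l x).toList.reverse := by
  convert foldl_of_growth (F := fun _ acc e => .cons e acc) (l := l) (a := fun _ => .nil)
    (id.hd'.cons id.tl'.hd') hl nil ?_ with x
  · have : ∀ (l : List BinTree) acc, l.foldl (fun acc e => BinTree.cons e acc) (ofList acc)
        = ofList (l.reverse ++ acc) := by
      intro l
      induction l with
      | nil => simp
      | cons e l ih => intro acc; simpa using ih (e :: acc)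
    simpa using (this (l x).toList []).symm
  · obtain ⟨_, q, hq⟩ := hl
    refine ⟨q + 1, fun x acc e he => ?_⟩
    have h1 := size_le_of_mem_toList he
    have h2 := (hq x).1
    simp only [size_cons, Polynomial.eval_add, Polynomial.eval_one]
    omega

theorem map {f : BinTree → BinTree → BinTree} {l : BinTree → BinTree}
    (hf : PolyTime fun y => f y.tl y.hd) (hl : PolyTime l) :
    PolyTime fun x => ofList ((l x).toList.map (f x)) := by
  have key : PolyTime fun x => (l x).toList.foldl (fun acc e => .cons (f x e) acc) .nil := by
    refine foldl_of_growth (F := fun x acc e => .cons (f x e) acc) (l := l) (a := fun _ => .nil)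
      ((hf.comp (id.hd'.cons id.tl'.tl')).cons id.tl'.hd') hl nil ?_
    obtain ⟨_, q, hq⟩ := hl
    obtain ⟨_, r, hr⟩ := hf
    refine ⟨r.comp (q + .X + 1) + 1, fun x acc e he => ?_⟩
    have h1 := size_le_of_mem_toList he
    have h2 := (hq x).1
    have h3 := (hr (.cons e x)).1
    have h4 : r.eval (BinTree.cons e x).size ≤ r.eval (q.eval x.size + x.size + 1) :=
      r.eval_le_eval_nat (by simp only [size_cons]; omega)
    simp only [tl_cons, hd_cons] at h3
    simp only [size_cons, Polynomial.eval_add, Polynomial.eval_one, Polynomial.eval_comp,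
      Polynomial.eval_X]
    omega
  convert key.reverse with x
  have : ∀ (l : List BinTree) acc, l.foldl (fun acc e => BinTree.cons (f x e) acc) (ofList acc)
      = ofList ((l.map (f x)).reverse ++ acc) := by
    intro l
    induction l with
    | nil => simp
    | cons e l ih => intro acc; simpa using ih (f x e :: acc)
  have h := this (l x).toList []
  rw [ofList_nil, List.append_nil] at h
  rw [h, toList_ofList, List.reverse_reverse]

theorem ofNat_len {c : BinTree → BinTree} (hc : PolyTime c) :
    PolyTime fun x => ofNat (c x).len := by
  convert map (f := fun _ _ => .nil) nil hc with x
  rw [List.map_const', ofNat, len]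

theorem range {c : BinTree → BinTree} (hc : PolyTime c) :
    PolyTime fun x => ofList ((List.range (c x).len).map ofNat) := by
  -- The accumulator is the next number together with the reversed list of its predecessors; `nil`
  -- plays the role of the pair of `0` and the empty list.
  have hit : ∀ m, (fun acc : BinTree => BinTree.cons (.cons .nil acc.hd) (.cons acc.hd acc.tl))^[m]
      .nil = if m = 0 then .nil else
        .cons (ofNat m) (ofList ((List.range m).map ofNat).reverse) := by
    intro m
    induction m with
    | zero => rfl
    | succ m ih =>
      rw [Function.iterate_succ_apply', ih]
      rcases Nat.eq_zero_or_pos m with rfl | hm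
      · rfl
      · simp [hm.ne', List.range_succ]
  have key : PolyTime fun x => (fun acc : BinTree => BinTree.cons (.cons .nil acc.hd)
      (.cons acc.hd acc.tl))^[(c x).len] .nil := by
    refine iterate (F := fun _ acc => .cons (.cons .nil acc.hd) (.cons acc.hd acc.tl))
      ((nil.cons id.hd'.hd').cons (id.hd'.hd'.cons id.hd'.tl')) hc nil ?_
    obtain ⟨_, q, hq⟩ := hc
    refine ⟨2 * q + q * (2 * q + 2) + 10, fun x m hm => ?_⟩
    rw [hit]
    split_ifs
    · simp
    · have h1 := size_ofList_le ((List.range m).map ofNat).reverse (2 * m + 1) (by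
        simp only [List.mem_reverse, List.mem_map, List.mem_range, forall_exists_index, and_imp,
          forall_apply_eq_imp_iff₂, size_ofNat]
        intro a ha
        omega)
      have h2 : m ≤ q.eval x.size := hm.trans ((c x).len_le_size.trans (hq x).1)
      have h3 : m * (2 * m + 1 + 1) ≤ q.eval x.size * (2 * q.eval x.size + 2) :=
        Nat.mul_le_mul h2 (by omega)
      simp only [List.length_reverse, List.length_map, List.length_range] at h1
      simp only [size_cons, size_ofNat, Polynomial.eval_add, Polynomial.eval_mul,
        Polynomial.eval_ofNat]
      omega
  convert key.tl'.reverse with x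
  rw [hit]
  split_ifs with h
  · simp [h]
  · simp

/-- Tables of values can be computed. -/
theorem table {F : BinTree → BinTree → BinTree} {c : BinTree → BinTree}
    (hF : PolyTime fun y => F y.tl y.hd) (hc : PolyTime c) :
    PolyTime fun x => tab (c x).len (F x) := by
  convert map hF hc.range with x
  rw [tab, toList_ofList, ← List.map_coe_finRange_eq_range, List.map_map, List.map_map]
  rfl

theorem foldl_or (l : List BinTree) (p : BinTree → Bool) (b : Bool) :
    l.foldl (fun acc e => .sel acc (ofBool true) (ofBool (p e))) (ofBool b)
      = ofBool (b || l.any p) := by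
  induction l generalizing b with
  | nil => simp
  | cons e l ih =>
    have : BinTree.sel (ofBool b) (ofBool true) (ofBool (p e)) = ofBool (b || p e) := by
      cases b <;> simp
    rw [List.foldl_cons, this, ih, List.any_cons, Bool.or_assoc]

theorem any {p : BinTree → BinTree → Bool} {l : BinTree → BinTree}
    (hp : PolyTime fun y => ofBool (p y.tl y.hd)) (hl : PolyTime l) :
    PolyTime fun x => ofBool ((l x).toList.any (p x)) := by
  convert foldl_of_growth (F := fun x acc e => .sel acc (ofBool true) (ofBool (p x e)))
    (l := l) (a := fun _ => ofBool false) ?_ hl nil ⟨3, fun x acc e _ => ?_⟩ with x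
  · rw [foldl_or]; simp
  · exact id.tl'.hd'.sel tru (hp.comp (id.hd'.cons id.tl'.tl'))
  · have h1 := size_ofBool_le (p x e)
    have h2 := size_ofBool_le true
    rw [Polynomial.eval_ofNat]
    cases acc <;> simp <;> omega

theorem exists_fin {p : BinTree → BinTree → Bool} {c : BinTree → BinTree}
    (hp : PolyTime fun y => ofBool (p y.tl y.hd)) (hc : PolyTime c) :
    PolyTime fun x => ofBool (ex (c x).len (p x)) := by
  convert any hp hc.range with x
  rw [ex, toList_ofList, ← List.map_coe_finRange_eq_range, List.map_map, List.any_map, Bool.eq_iff_iff]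
  simp

theorem all {p : BinTree → BinTree → Bool} {l : BinTree → BinTree}
    (hp : PolyTime fun y => ofBool (p y.tl y.hd)) (hl : PolyTime l) :
    PolyTime fun x => ofBool ((l x).toList.all (p x)) := by
  convert (any (p := fun x e => !p x e) hp.not hl).not with x
  rw [List.all_eq_not_any_not]

theorem foldl_count (l : List BinTree) (p : BinTree → Bool) (n : ℕ) :
    l.foldl (fun acc e => .sel (ofBool (p e)) (.cons .nil acc) acc) (ofNat n)
      = ofNat (n + l.countP p) := by
  induction l generalizing n with
  | nil => simp
  | cons e l ih =>
    rw [List.foldl_cons, List.countP_cons]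
    cases h : p e
    · simpa [ofBool_false] using ih n
    · rw [sel_ofBool, if_pos rfl, ← ofNat_succ, ih]
      congr 1
      simp; omega

theorem countP {p : BinTree → BinTree → Bool} {l : BinTree → BinTree}
    (hp : PolyTime fun y => ofBool (p y.tl y.hd)) (hl : PolyTime l) :
    PolyTime fun x => ofNat ((l x).toList.countP (p x)) := by
  convert foldl_of_growth (F := fun x acc e => .sel (ofBool (p x e)) (.cons .nil acc) acc)
    (l := l) (a := fun _ => .nil) ?_ hl nil ⟨3, fun x acc e _ => ?_⟩ with x
  · have := foldl_count (l x).toList (p x) 0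
    rw [ofNat_zero] at this
    rw [this, zero_add]
  · exact (hp.comp (id.hd'.cons id.tl'.tl')).sel (nil.cons id.tl'.hd') id.tl'.hd'
  · rw [Polynomial.eval_ofNat, sel_ofBool]
    split_ifs
    · simp only [size_cons, size_nil]; omega
    · omega

end PolyTime

/-! ### Functions on numbers that can be computed in polynomial time -/

namespace BinTree

/-- Used in place of the size to bound values of arbitrary programs: an assignment such as `x :=
cons x x` doubles the size, but raises the depth by one only. For unary numbers the depth is the
number itself. -/
def depth : BinTree → ℕ
  | nil => 0
  | cons a b => max a.depth b.depth + 1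

theorem depth_hd_le (t : BinTree) : t.hd.depth ≤ t.depth := by
  cases t <;> simp only [hd_nil, hd_cons, depth, le_refl]; omega

theorem depth_tl_le (t : BinTree) : t.tl.depth ≤ t.depth := by
  cases t <;> simp only [tl_nil, tl_cons, depth, le_refl]; omega

theorem depth_ofNat (n : ℕ) : (ofNat n).depth = n := by
  induction n with
  | zero => rfl
  | succ n ih => simp [depth, ih]

end BinTree

/-- A bound for the variables and for the nesting depth of an expression. -/
def TreeExpr.bound : TreeExpr → ℕ
  | .nil => 0
  | .var x => x + 1
  | .cons e f => max e.bound f.bound + 1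
  | .hd e => e.bound
  | .tl e => e.bound

/-- The values `s` of the variables below `M`, the values `r` of the others. -/
def glue (M : ℕ) (s r : ℕ → BinTree) : ℕ → BinTree := fun i => if i < M then s i else r i

theorem TreeExpr.eval_glue {M : ℕ} (s r : ℕ → BinTree) {e : TreeExpr} (h : e.bound ≤ M) :
    e.eval (glue M s r) = e.eval s := by
  induction e with
  | nil => rfl
  | var x =>
    simp only [bound] at h
    simp only [eval, glue]
    rw [if_pos (by omega)]
  | cons e f ihe ihf =>
    simp only [bound] at h
    simp only [eval]
    rw [ihe (by omega), ihf (by omega)]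
  | hd e ih => simp only [bound] at h; simp only [eval]; rw [ih h]
  | tl e ih => simp only [bound] at h; simp only [eval]; rw [ih h]

theorem TreeExpr.depth_eval_le {s : ℕ → BinTree} {D : ℕ} (hs : ∀ i, (s i).depth ≤ D)
    (e : TreeExpr) : (e.eval s).depth ≤ D + e.bound := by
  induction e with
  | nil => simp [BinTree.depth]
  | var x => simp only [eval, bound]; have := hs x; omega
  | cons e f ihe ihf => simp only [eval, bound, BinTree.depth]; omega
  | hd e ih => exact (BinTree.depth_hd_le _).trans ih
  | tl e ih => exact (BinTree.depth_tl_le _).trans ih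

theorem update_glue {M x : ℕ} (hx : x < M) (s r : ℕ → BinTree) (v : BinTree) :
    Function.update (glue M s r) x v = glue M (Function.update s x v) r := by
  funext i
  simp only [Function.update, glue]
  by_cases h : i = x
  · subst h; simp [hx]
  · simp [h]

namespace TreeProg

/-- A bound for the variables and for the nesting depth of the expressions of a program. -/
def bound : TreeProg → ℕ
  | assign x e => max (x + 1) e.bound
  | flip x => x + 1
  | seq P Q => max P.bound Q.bound
  | ite e P Q => max e.bound (max P.bound Q.bound)
  | loop e P => max e.bound P.bound

open Classical in
/-- One step of the computation when every coin shows `false`. -/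
noncomputable def detStep : Cfg → Cfg
  | ([], s) => ([], s)
  | (assign x e :: K, s) => (K, Function.update s x (e.eval s))
  | (flip x :: K, s) => (K, Function.update s x .nil)
  | (seq P Q :: K, s) => (P :: Q :: K, s)
  | (ite e P Q :: K, s) => if e.eval s = .nil then (Q :: K, s) else (P :: K, s)
  | (loop e P :: K, s) => if e.eval s = .nil then (K, s) else (P :: loop e P :: K, s)

theorem detStep_mem_support (c : Cfg) : detStep c ∈ (step c).support := by
  obtain ⟨_ | ⟨P, K⟩, s⟩ := c
  · simp [step, detStep]
  · cases P with
    | flip x =>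
      rw [step, PMF.mem_support_map_iff]
      exact ⟨false, by simp, rfl⟩
    | _ => simp [step, detStep]

/-- The path on which all coins show `false` is one of the possible computations, so whatever holds
for all outcomes holds at its end. -/
theorem iterate_detStep_mem_support (t : ℕ) (c : Cfg) : detStep^[t] c ∈ (run t c).support := by
  induction t generalizing c with
  | zero => simp [run]
  | succ t ih =>
    rw [run, PMF.mem_support_bind_iff]
    exact ⟨_, detStep_mem_support c, ih _⟩

/-- The program in which every coin shows `false`. -/
def derand : TreeProg → TreeProg
  | assign x e => assign x e
  | flip x => assign x .nil
  | seq P Q => seq P.derand Q.derand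
  | ite e P Q => ite e P.derand Q.derand
  | loop e P => loop e P.derand

theorem step_derand (P : TreeProg) (K K₀ : List TreeProg) (s : ℕ → BinTree) :
    step ((P :: K).map derand ++ K₀, s) =
      PMF.pure ((detStep (P :: K, s)).1.map derand ++ K₀, (detStep (P :: K, s)).2) := by
  cases P with
  | ite e P Q =>
    simp only [List.map_cons, List.cons_append, derand, step, detStep]
    split_ifs <;> simp
  | loop e P =>
    simp only [List.map_cons, List.cons_append, derand, step, detStep]
    split_ifs <;> simp [derand]
  | _ => simp [step, detStep, derand]

/-- The time `t` must be the first halting time: once `K` is exhausted, `detStep` stands still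
whereas the subroutine would already go on with `K₀`. -/
theorem reaches_derand {t : ℕ} {K : List TreeProg} {s : ℕ → BinTree}
    (h : (detStep^[t] (K, s)).1 = []) (h' : ∀ u < t, (detStep^[u] (K, s)).1 ≠ [])
    (K₀ : List TreeProg) :
    Reaches (K.map derand ++ K₀, s) t (K₀, (detStep^[t] (K, s)).2) := by
  induction t generalizing K s with
  | zero =>
    simp only [Function.iterate_zero, id_eq] at h
    subst h
    exact fun N => by simp
  | succ t ih =>
    cases K with
    | nil => exact absurd rfl (h' 0 (by omega))
    | cons P K =>
      have h1 := ih (K := (detStep (P :: K, s)).1) (s := (detStep (P :: K, s)).2) h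
        fun u hu => h' (u + 1) (by omega)
      have h2 := (reaches_of_step (step_derand P K K₀ s)).trans h1
      rwa [add_comm 1 t] at h2

/-- Everything that ever remains to be executed is a part of the initial programs, so the variables
from `M` on are neither read nor written. This allows variable `M` to hold the stack during a
foreign program. -/
theorem detStep_glue {M : ℕ} (K : List TreeProg) (hK : ∀ P ∈ K, P.bound ≤ M)
    (s r : ℕ → BinTree) :
    detStep (K, glue M s r) = ((detStep (K, s)).1, glue M (detStep (K, s)).2 r) ∧
      (∀ P ∈ (detStep (K, s)).1, P.bound ≤ M) ∧
      ∀ D, (∀ i, (s i).depth ≤ D) → ∀ i, ((detStep (K, s)).2 i).depth ≤ D + M := by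
  cases K with
  | nil =>
    refine ⟨by simp [detStep], by simp [detStep], fun D hD i => ?_⟩
    have := hD i
    simp only [detStep]; omega
  | cons P K =>
    have hP := hK P (by simp)
    have hK' : ∀ P ∈ K, P.bound ≤ M := fun Q hQ => hK Q (by simp [hQ])
    have hD' : ∀ D, (∀ i, (s i).depth ≤ D) → ∀ i, (s i).depth ≤ D + M := fun D hD i =>
      (hD i).trans (by omega)
    cases P with
    | assign x e =>
      simp only [bound] at hP
      refine ⟨?_, hK', fun D hD i => ?_⟩
      · rw [detStep, detStep, update_glue (by omega), TreeExpr.eval_glue _ _ (by omega)]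
      · have h1 := hD i
        have h2 := e.depth_eval_le hD
        simp only [detStep, Function.update_apply]
        split_ifs <;> omega
    | flip x =>
      simp only [bound] at hP
      refine ⟨?_, hK', fun D hD i => ?_⟩
      · rw [detStep, detStep, update_glue (by omega)]
      · have h1 := hD i
        simp only [detStep, Function.update_apply]
        split_ifs
        · simp [BinTree.depth]
        · omega
    | seq P Q =>
      simp only [bound] at hP
      exact ⟨rfl, by simp only [detStep, List.mem_cons, forall_eq_or_imp]; exact
        ⟨by omega, by omega, hK'⟩, hD'⟩
    | ite e P Q =>
      simp only [bound] at hP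
      simp only [detStep]
      rw [TreeExpr.eval_glue _ _ (by omega)]
      split_ifs
      · exact ⟨rfl, by simp only [List.mem_cons, forall_eq_or_imp]; exact ⟨by omega, hK'⟩, hD'⟩
      · exact ⟨rfl, by simp only [List.mem_cons, forall_eq_or_imp]; exact ⟨by omega, hK'⟩, hD'⟩
    | loop e P =>
      have hP' := hP
      simp only [bound] at hP
      simp only [detStep]
      rw [TreeExpr.eval_glue _ _ (by omega)]
      split_ifs
      · exact ⟨rfl, hK', hD'⟩
      · exact ⟨rfl, by simp only [List.mem_cons, forall_eq_or_imp]; exact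
          ⟨by omega, hP', hK'⟩, hD'⟩

theorem iterate_detStep_glue {M : ℕ} (t : ℕ) (K : List TreeProg) (hK : ∀ P ∈ K, P.bound ≤ M)
    (s r : ℕ → BinTree) :
    detStep^[t] (K, glue M s r) = ((detStep^[t] (K, s)).1, glue M (detStep^[t] (K, s)).2 r) ∧
      ∀ D, (∀ i, (s i).depth ≤ D) → ∀ i, ((detStep^[t] (K, s)).2 i).depth ≤ D + t * M := by
  induction t generalizing K s with
  | zero => exact ⟨rfl, fun D hD i => by simpa using hD i⟩
  | succ t ih =>
    obtain ⟨h1, h2, h3⟩ := detStep_glue K hK s r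
    obtain ⟨h4, h5⟩ := ih _ h2 (detStep (K, s)).2
    simp only [Function.iterate_succ_apply]
    refine ⟨by rw [h1]; exact h4, fun D hD i => ?_⟩
    have := h5 _ (h3 D hD) i
    rw [add_mul]
    have h6 : (((detStep (K, s)).1, (detStep (K, s)).2) : Cfg) = detStep (K, s) := rfl
    rw [h6] at this
    omega

/-- The program that sets the variables `1, …, m + 1` to `nil`. -/
def clear : ℕ → TreeProg
  | 0 => assign 1 .nil
  | m + 1 => seq (clear m) (assign (m + 2) .nil)

theorem execIn_clear (m : ℕ) (s : ℕ → BinTree) :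
    ExecIn (clear m) s (2 * m + 1) fun i => if 1 ≤ i ∧ i ≤ m + 1 then .nil else s i := by
  induction m with
  | zero =>
    refine execIn_assign ?_
    funext i
    simp only [Function.update_apply, TreeExpr.eval]
    by_cases h : i = 1
    · subst h; rfl
    · rw [if_neg h, if_neg (by omega)]
  | succ m ih =>
    have := ih.seq (Q := assign (m + 2) .nil) (execIn_assign rfl)
    convert this using 1
    · rfl
    · omega
    · funext i
      simp only [Function.update_apply, TreeExpr.eval]
      by_cases h : i = m + 2
      · rw [if_pos h, if_pos (by omega)]
      · rw [if_neg h]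
        by_cases h' : 1 ≤ i ∧ i ≤ m + 1
        · rw [if_pos h', if_pos (by omega)]
        · rw [if_neg h', if_neg (by omega)]

end TreeProg

-- The program for `k` may toss coins, knows of no stack and leaves garbage behind. All its coins
-- are replaced by `false`, which is harmless since every outcome yields `k n`; the stack is parked
-- in variable `M` meanwhile, and the used variables are cleared afterwards.
set_option maxHeartbeats 400000 in
theorem PolyTimeComputable.polyTime {k : ℕ → ℕ} (hk : PolyTimeComputable k) :
    PolyTime fun x => .ofNat (k x.len) := by
  obtain ⟨P, p, hP⟩ := hk
  obtain ⟨Q, q, hQ⟩ := PolyTime.ofNat_len PolyTime.id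
  set m := P.bound + 1 with hm
  set M := m + 2 with hM
  refine ⟨.seq Q <| .seq (.assign M (.var 1)) <| .seq (.assign 1 .nil) <| .seq P.derand <|
    .seq (clear m) <| .seq (.assign 1 (.var M)) (.assign M .nil),
    q + p + .C (2 * m + 20) + .C 2 * (.X + p * .C M), fun x => ?_⟩
  obtain ⟨-, t, ht, h1⟩ := hQ x
  set n := x.len with hn
  have hnx : n ≤ x.size := x.len_le_size
  have hpn : p.eval n ≤ p.eval x.size := p.eval_le_eval_nat hnx
  have h2 := hP n _ (iterate_detStep_mem_support (p.eval n) _)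
  rw [init_eq] at h2
  have h3 := iterate_detStep_glue (M := M) (p.eval n) [P] (by simp; omega)
    (vals (.ofNat n) .nil .nil)
  set c := detStep^[p.eval n] ([P], vals (.ofNat n) .nil .nil) with hc
  have hsize : (BinTree.ofNat (k n)).size ≤ 2 * (x.size + p.eval x.size * M) + 1 := by
    -- The depth grows by at most `M` per step, and the result is a unary number, whose depth is `k
    -- n`.
    have h4 := (h3 (fun _ => .nil)).2 n (fun i => by
      rcases i with _ | _ | _ | i <;> simp [vals, BinTree.depth, BinTree.depth_ofNat]) 0
    rw [h2.2, BinTree.depth_ofNat] at h4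
    rw [BinTree.size_ofNat]
    have := Nat.mul_le_mul_right M hpn
    omega
  refine ⟨?_, ?_⟩
  · simp only [Polynomial.eval_add, Polynomial.eval_mul, Polynomial.eval_C, Polynomial.eval_X]
    rw [← hn]
    omega
  have h5 : ∃ u ≤ p.eval n, ∃ s : ℕ → BinTree, s 0 = .ofNat (k n) ∧
      ∀ S, ExecIn P.derand (glue M (vals (.ofNat n) .nil .nil)
        (Function.update (fun _ => .nil) M S)) u
        (glue M s (Function.update (fun _ => .nil) M S)) := by
    have hex : ∃ u, (detStep^[u] ([P], vals (.ofNat n) .nil .nil)).1 = [] := ⟨_, h2.1⟩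
    classical
    have hle : Nat.find hex ≤ p.eval n := Nat.find_min' hex h2.1
    have hfix : detStep^[p.eval n] ([P], vals (.ofNat n) .nil .nil)
        = detStep^[Nat.find hex] ([P], vals (.ofNat n) .nil .nil) := by
      obtain ⟨v, hv⟩ := Nat.exists_eq_add_of_le' hle
      have h6 := Nat.find_spec hex
      rw [hv, Function.iterate_add_apply]
      generalize detStep^[Nat.find hex] ([P], vals (.ofNat n) .nil .nil) = c' at h6
      obtain ⟨K, s⟩ := c'
      simp only at h6
      subst h6
      exact Function.iterate_fixed (by simp [detStep]) v
    refine ⟨Nat.find hex, hle, (detStep^[Nat.find hex] ([P], vals (.ofNat n) .nil .nil)).2, ?_,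
      fun S K₀ => ?_⟩
    · rw [← hfix]; exact h2.2
    · have hg := fun u => (iterate_detStep_glue (M := M) u [P] (by simp; omega)
        (vals (.ofNat n) .nil .nil) (Function.update (fun _ => .nil) M S)).1
      have := reaches_derand (t := Nat.find hex) (K := [P])
        (s := glue M (vals (.ofNat n) .nil .nil) (Function.update (fun _ => .nil) M S))
        (by rw [hg]; exact Nat.find_spec hex)
        (fun u hu => by rw [hg]; exact Nat.find_min hex hu) K₀
      rw [hg] at this
      exact this
  obtain ⟨u, hu, s, hs, h5⟩ := h5
  refine ⟨_, ?_, fun S => (h1 S).seq <| (execIn_assign rfl).seq <|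
    (execIn_assign (s' := glue M (vals (.ofNat n) .nil .nil)
      (Function.update (fun _ => .nil) M S)) ?_).seq <| (h5 S).seq <| (execIn_clear m _).seq <|
    (execIn_assign rfl).seq (execIn_assign ?_)⟩
  · simp only [Polynomial.eval_add, Polynomial.eval_mul, Polynomial.eval_C, Polynomial.eval_X]
    omega
  · funext i
    simp only [Function.update_apply, glue, TreeExpr.eval, vals_one]
    rcases i with _ | _ | i
    · rw [if_neg (by omega), if_neg (by omega), if_pos (by omega)]; rfl
    · rw [if_pos rfl, if_pos (by omega)]; rfl
    · rw [if_neg (by omega)]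
      have hv : vals (.ofNat n) .nil .nil (i + 1 + 1) = .nil := by cases i <;> rfl
      have hv' : st (.ofNat n) S (i + 1 + 1) = .nil := by cases i <;> rfl
      rw [hv, hv']
      split_ifs <;> first | rfl | omega
  · funext i
    simp only [Function.update_apply, glue, TreeExpr.eval]
    rcases i with _ | _ | i
    · rw [if_neg (by omega), if_neg (by omega), if_neg (by omega), if_pos (by omega), hs]; rfl
    · rw [if_neg (by omega), if_pos rfl, if_neg (by omega), if_neg (by omega)]; simp
    · have hv : st (.ofNat (k n)) S (i + 1 + 1) = .nil := by cases i <;> rfl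
      rw [hv]
      split_ifs <;> first | rfl | omega

/-! ### Randomized subroutines -/

theorem PMF.bind_congr_support {α β : Type*} {p : PMF α} {f g : α → PMF β}
    (h : ∀ a ∈ p.support, f a = g a) : p.bind f = p.bind g := by
  ext b
  simp only [PMF.bind_apply]
  refine tsum_congr fun a => ?_
  by_cases ha : p a = 0
  · simp [ha]
  · rw [h a ((PMF.mem_support_iff p a).2 ha)]

theorem PMF.uniformOfFintype_bind_map {α β γ δ : Type*} [Fintype α] [Nonempty α] [Fintype β]
    [Nonempty β] [Fintype γ] [Nonempty γ] (e : α × β ≃ γ) (F : α → β → δ) (G : γ → δ)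
    (h : ∀ a b, G (e (a, b)) = F a b) :
    ((PMF.uniformOfFintype α).bind fun a => (PMF.uniformOfFintype β).map (F a)) =
      (PMF.uniformOfFintype γ).map G := by
  classical
  ext c
  have hcard : (Fintype.card γ : ENNReal)⁻¹ =
      (Fintype.card α : ENNReal)⁻¹ * (Fintype.card β : ENNReal)⁻¹ := by
    rw [← Fintype.card_congr e, Fintype.card_prod, Nat.cast_mul,
      ENNReal.mul_inv (by simp) (by simp)]
  simp only [PMF.bind_apply, PMF.map_apply, PMF.uniformOfFintype_apply, tsum_fintype]
  rw [← e.sum_comp, Fintype.sum_prod_type]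
  refine Finset.sum_congr rfl fun a _ => ?_
  rw [Finset.mul_sum]
  refine Finset.sum_congr rfl fun b _ => ?_
  rw [h, hcard]
  split_ifs <;> simp

namespace TreeProg

theorem run_add (t N : ℕ) (c : Cfg) : run (t + N) c = (run t c).bind (run N) := by
  induction t generalizing c with
  | zero => simp [run]
  | succ t ih =>
    rw [show t + 1 + N = t + N + 1 by omega, run, run, PMF.bind_bind]
    congr 1
    funext c'
    exact ih c'

theorem run_nil (N : ℕ) (s : ℕ → BinTree) : run N ([], s) = PMF.pure ([], s) := by
  induction N with
  | zero => rfl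
  | succ N ih => rw [run, step, PMF.pure_bind, ih]

theorem HaltsWithin.run_add {P : TreeProg} {x : BinTree} {t : ℕ} (h : P.HaltsWithin x t) (N : ℕ) :
    run (t + N) (P.init x) = run t (P.init x) := by
  rw [TreeProg.run_add]
  conv_rhs => rw [← PMF.bind_pure (run t (P.init x))]
  refine PMF.bind_congr_support fun c hc => ?_
  have := h c hc
  obtain ⟨K, s⟩ := c
  simp only at this
  subst this
  exact run_nil N s

end TreeProg

/-- The random function `g` is computed by a subroutine whose running time is polynomially bounded
and does not depend on the coins. -/
def RandTime (g : BinTree → PMF BinTree) : Prop :=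
  ∃ (P : TreeProg) (q : Polynomial ℕ), ∀ x, (∀ y ∈ (g x).support, y.size ≤ q.eval x.size) ∧
    ∃ t ≤ q.eval x.size, ∀ S K N,
      run (t + N) (P :: K, st x S) = (g x).bind fun y => run N (K, st y S)

/-- The list of `n` independent samples, in front of `acc`. -/
noncomputable def PMF.rep (μ : PMF BinTree) : ℕ → BinTree → PMF BinTree
  | 0, acc => PMF.pure acc
  | n + 1, acc => μ.bind fun y => PMF.rep μ n (.cons y acc)

theorem PMF.size_le_of_mem_support_rep {μ : PMF BinTree} {B : ℕ}
    (h : ∀ y ∈ μ.support, y.size ≤ B) (n : ℕ) (acc : BinTree) :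
    ∀ y ∈ (μ.rep n acc).support, y.size ≤ acc.size + n * (B + 1) := by
  induction n generalizing acc with
  | zero => simp [rep]
  | succ n ih =>
    intro y hy
    rw [rep, mem_support_bind_iff] at hy
    obtain ⟨z, hz, hy⟩ := hy
    have h1 := ih _ y hy
    have h2 := h z hz
    simp only [BinTree.size_cons] at h1
    rw [add_mul]
    omega

theorem PMF.rep_map_uniformOfFintype {Ω : Type*} [Fintype Ω] [Nonempty Ω] (h : Ω → BinTree)
    (n : ℕ) (acc : List BinTree) :
    ((PMF.uniformOfFintype Ω).map h).rep n (.ofList acc) =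
      (PMF.uniformOfFintype (Fin n → Ω)).map fun ω =>
        .ofList ((List.finRange n).map (fun i => h (ω i)) ++ acc) := by
  induction n generalizing acc with
  | zero =>
    simp only [rep, List.finRange_zero, List.map_nil, List.nil_append]
    exact ((PMF.uniformOfFintype (Fin 0 → Ω)).map_const _).symm
  | succ n ih =>
    rw [rep, PMF.bind_map]
    have : ((fun y => ((PMF.uniformOfFintype Ω).map h).rep n (.cons y (.ofList acc))) ∘ h) =
        fun o => (PMF.uniformOfFintype (Fin n → Ω)).map fun ω =>
          BinTree.ofList ((List.finRange n).map (fun i => h (ω i)) ++ h o :: acc) := by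
      funext o
      exact ih (h o :: acc)
    rw [this]
    -- Samples are pushed to the front, so the one drawn first becomes the last entry of the list:
    -- hence `snoc`.
    refine PMF.uniformOfFintype_bind_map (Fin.snocEquiv fun _ => Ω) _ _ fun o ω => ?_
    simp [List.finRange_succ_last, Fin.snocEquiv, Function.comp_def]

namespace RandTime

theorem coin : RandTime fun _ => (PMF.uniformOfFintype Bool).map BinTree.ofBool := by
  refine ⟨.flip 0, 3, fun x => ⟨fun y hy => ?_, 1, by simp, fun S K N => ?_⟩⟩
  · rw [PMF.mem_support_map_iff] at hy
    obtain ⟨b, -, rfl⟩ := hy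
    rw [Polynomial.eval_ofNat]
    exact BinTree.size_ofBool_le b
  · rw [add_comm, run, step, PMF.bind_map, PMF.bind_map]
    simp only [Function.comp_def, update_vals_zero]

theorem comp {g : BinTree → PMF BinTree} {f : BinTree → BinTree} (hg : RandTime g)
    (hf : PolyTime f) : RandTime fun x => g (f x) := by
  obtain ⟨P, q, hP⟩ := hg
  obtain ⟨Q, r, hQ⟩ := hf
  refine ⟨.seq Q P, r + q.comp r + 1, fun x => ?_⟩
  obtain ⟨h1, t, ht, h2⟩ := hQ x
  obtain ⟨h3, u, hu, h4⟩ := hP (f x)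
  have h5 := q.eval_le_eval_nat h1
  simp only [Polynomial.eval_add, Polynomial.eval_comp, Polynomial.eval_one]
  refine ⟨fun y hy => by have := h3 y hy; omega, 1 + (t + u), by omega, fun S K N => ?_⟩
  have h6 : Reaches (.seq Q P :: K, st x S) 1 (Q :: P :: K, st x S) :=
    reaches_of_step (by rw [step])
  rw [add_assoc, h6, add_assoc, h2, h4]

/-- The program that repeats `P` as long as the list `hd (var 0)` is not empty. -/
def repBody (P : TreeProg) : TreeProg :=
  .seq (.seq (.assign 1 (.cons (.var 0) (.var 1))) (.assign 0 (.tl (.tl (.var 0))))) <|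
  .seq P <| .seq (.assign 0 (.cons (.tl (.hd (.hd (.var 1))))
      (.cons (.cons (.var 0) (.hd (.tl (.hd (.var 1))))) (.tl (.tl (.hd (.var 1)))))))
    (.assign 1 (.tl (.var 1)))

theorem run_rep {P : TreeProg} {μ : PMF BinTree} {env : BinTree} {t : ℕ}
    (hP : ∀ S K N, run (t + N) (P :: K, st env S) = μ.bind fun y => run N (K, st y S))
    (S : BinTree) (K : List TreeProg) (N : ℕ) (l : List BinTree) (acc : BinTree) :
    run (l.length * (t + 9) + 1 + N) (.loop (.hd (.var 0)) (repBody P) :: K,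
      st (.cons (.ofList l) (.cons acc env)) S) =
    (μ.rep l.length acc).bind fun y => run N (K, st (.cons .nil (.cons y env)) S) := by
  induction l generalizing acc with
  | nil =>
    simp only [List.length_nil, zero_mul, zero_add, PMF.rep, PMF.pure_bind]
    exact execIn_loop_nil (by simp) K N
  | cons e l ih =>
    simp only [List.length_cons, PMF.rep, PMF.bind_bind]
    have e1 : (l.length + 1) * (t + 9) + 1 + N =
        1 + (1 + (1 + (1 + 1) + (1 + (t + (1 + (1 + 1) + (l.length * (t + 9) + 1 + N)))))) := by
      ring
    have h1 : ∀ N, run (1 + N) (.loop (.hd (.var 0)) (repBody P) :: K,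
        st (.cons (.ofList (e :: l)) (.cons acc env)) S) = run N
          (repBody P :: .loop (.hd (.var 0)) (repBody P) :: K,
            st (.cons (.ofList (e :: l)) (.cons acc env)) S) :=
      reaches_of_step (by rw [step, if_neg (by simp)])
    have h2 : ∀ Q R K s N, run (1 + N) (.seq Q R :: K, s) = run N (Q :: R :: K, s) :=
      fun Q R K s => reaches_of_step (by rw [step])
    rw [e1, h1]
    conv_lhs => rw [repBody]
    rw [h2, ((execIn_assign rfl).seq (execIn_assign rfl)) _ _, h2]
    simp only [TreeExpr.eval, vals_zero, vals_one, BinTree.tl_cons,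
      update_vals_zero, update_vals_one, BinTree.ofList_cons]
    rw [hP]
    congr 1
    funext y
    rw [((execIn_assign rfl).seq (execIn_assign rfl)) _ _]
    simp only [TreeExpr.eval, vals_zero, vals_one, BinTree.hd_cons, BinTree.tl_cons,
      update_vals_zero, update_vals_one]
    exact ih (.cons y acc)

/-- The head of the argument is the number of repetitions and the tail the argument of `g`, so that
nested repetitions consume a list of sizes entry by entry. -/
theorem rep {g : BinTree → PMF BinTree} (hg : RandTime g) :
    RandTime fun x => (g x.tl).rep x.hd.len .nil := by
  obtain ⟨P, q, hP⟩ := hg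
  refine ⟨.seq (.assign 0 (.cons (.hd (.var 0)) (.cons .nil (.tl (.var 0))))) <|
    .seq (.loop (.hd (.var 0)) (repBody P)) (.assign 0 (.hd (.tl (.var 0)))),
    .X * (q + 9) + 10, fun x => ?_⟩
  obtain ⟨h1, t, ht, h2⟩ := hP x.tl
  have h3 : q.eval x.tl.size ≤ q.eval x.size := q.eval_le_eval_nat x.size_tl_le
  have h4 : x.hd.len ≤ x.size := x.hd.len_le_size.trans x.size_hd_le
  have h5 : x.hd.len * (t + 9) ≤ x.size * (q.eval x.size + 9) :=
    Nat.mul_le_mul h4 (by omega)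
  simp only [Polynomial.eval_add, Polynomial.eval_mul, Polynomial.eval_X, Polynomial.eval_ofNat]
  refine ⟨fun y hy => ?_, 1 + (1 + (1 + (x.hd.len * (t + 9) + 1 + 1))), by omega,
    fun S K N => ?_⟩
  · have h6 := PMF.size_le_of_mem_support_rep h1 _ _ y hy
    have h7 : x.hd.len * (q.eval x.tl.size + 1) ≤ x.size * (q.eval x.size + 9) :=
      Nat.mul_le_mul h4 (by omega)
    simp only [BinTree.size_nil] at h6
    omega
  · have h6 : ∀ Q R K s N, run (1 + N) (.seq Q R :: K, s) = run N (Q :: R :: K, s) :=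
      fun Q R K s => reaches_of_step (by rw [step])
    have h7 : ∀ x e K s N, run (1 + N) (.assign x e :: K, s) =
      run N (K, Function.update s x (e.eval s)) := fun x e K s => execIn_assign rfl K
    have e1 : 1 + (1 + (1 + (x.hd.len * (t + 9) + 1 + 1))) + N =
        1 + (1 + (1 + (x.hd.len * (t + 9) + 1 + (1 + N)))) := by ring
    rw [e1, h6, h7, h6]
    have h8 := run_rep h2 S (.assign 0 (.hd (.tl (.var 0))) :: K) (1 + N) x.hd.toList .nil
    rw [BinTree.ofList_toList] at h8
    simp only [TreeExpr.eval, vals_zero, update_vals_zero]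
    refine h8.trans ?_
    congr 1
    funext y
    rw [h7]
    simp

/-- Carries the instance past the sampling, which overwrites its argument. -/
theorem pair {g : BinTree → PMF BinTree} (hg : RandTime g) :
    RandTime fun x => (g x.hd).map fun y => .cons y x.tl := by
  obtain ⟨P, q, hP⟩ := hg
  refine ⟨.seq (.assign 1 (.cons (.tl (.var 0)) (.var 1))) <| .seq (.assign 0 (.hd (.var 0))) <|
    .seq P <| .seq (.assign 0 (.cons (.var 0) (.hd (.var 1)))) (.assign 1 (.tl (.var 1))),
    q + .X + 10, fun x => ?_⟩
  obtain ⟨h1, t, ht, h2⟩ := hP x.hd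
  have h3 : q.eval x.hd.size ≤ q.eval x.size := q.eval_le_eval_nat x.size_hd_le
  simp only [Polynomial.eval_add, Polynomial.eval_X, Polynomial.eval_ofNat]
  refine ⟨fun y hy => ?_, 1 + (1 + (1 + (1 + (1 + (t + (1 + (1 + 1))))))), by omega,
    fun S K N => ?_⟩
  · rw [PMF.mem_support_map_iff] at hy
    obtain ⟨z, hz, rfl⟩ := hy
    have h4 := h1 z hz
    have h5 := x.size_tl_le
    rw [BinTree.size_cons]
    omega
  · have h6 : ∀ Q R K s N, run (1 + N) (.seq Q R :: K, s) = run N (Q :: R :: K, s) :=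
      fun Q R K s => reaches_of_step (by rw [step])
    have h7 : ∀ x e K s N, run (1 + N) (.assign x e :: K, s) =
      run N (K, Function.update s x (e.eval s)) := fun x e K s => execIn_assign rfl K
    have e1 : 1 + (1 + (1 + (1 + (1 + (t + (1 + (1 + 1))))))) + N =
        1 + (1 + (1 + (1 + (1 + (t + (1 + (1 + (1 + N)))))))) := by ring
    rw [e1, h6, h7, h6, h7, h6]
    simp only [TreeExpr.eval, vals_zero, vals_one, update_vals_zero, update_vals_one]
    rw [h2, PMF.bind_map]
    congr 1
    funext y
    rw [h6, h7, h7]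
    simp

/-- Random preprocessing, followed by a program. -/
theorem exists_treeProg {g : BinTree → PMF BinTree} (hg : RandTime g) {G : BinTree → BinTree}
    (hG : PolyTime G) (P : TreeProg) (p : Polynomial ℕ) :
    ∃ (P' : TreeProg) (p' : Polynomial ℕ), ∀ x,
      (∀ y ∈ (g x).support, P.HaltsWithin (G y) (p.eval (G y).size)) →
      run (p'.eval x.size) (P'.init x) =
        (g x).bind fun y => run (p.eval (G y).size) (P.init (G y)) := by
  obtain ⟨Q, q, hQ⟩ := hg
  obtain ⟨R, r, hR⟩ := hG
  refine ⟨.seq Q (.seq R P), q + r.comp q + p.comp (r.comp q) + 2, fun x hx => ?_⟩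
  obtain ⟨h1, t, ht, h2⟩ := hQ x
  obtain ⟨N, hN⟩ := Nat.exists_eq_add_of_le ht
  have h6 : ∀ Q R K s N, run (1 + N) (.seq Q R :: K, s) = run N (Q :: R :: K, s) :=
    fun Q R K s => reaches_of_step (by rw [step])
  have e1 : (q + r.comp q + p.comp (r.comp q) + 2).eval x.size = 1 + (t + (1 +
      (r.eval (q.eval x.size) + p.eval (r.eval (q.eval x.size)) + N))) := by
    simp only [Polynomial.eval_add, Polynomial.eval_comp, Polynomial.eval_ofNat]
    omega
  rw [e1, init_eq, h6, h2]
  refine PMF.bind_congr_support fun y hy => ?_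
  obtain ⟨h3, u, hu, h4⟩ := hR y
  have h5 : r.eval y.size ≤ r.eval (q.eval x.size) := r.eval_le_eval_nat (h1 y hy)
  have h7 : p.eval (G y).size ≤ p.eval (r.eval (q.eval x.size)) :=
    p.eval_le_eval_nat (h3.trans h5)
  -- The deterministic preprocessing time depends on the sample while the clock does not; the
  -- surplus `M` is spent in halted configurations.
  obtain ⟨M, hM⟩ := Nat.exists_eq_add_of_le (show u + p.eval (G y).size ≤
    r.eval (q.eval x.size) + p.eval (r.eval (q.eval x.size)) + N by omega)
  rw [h6, hM, add_assoc, h4, ← init_eq, (hx y hy).run_add]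

end RandTime

theorem PMF.toOuterMeasure_le_one {α : Type*} (μ : PMF α) (s : Set α) : μ.toOuterMeasure s ≤ 1 := by
  rw [← (μ.toOuterMeasure_apply_eq_one_iff Set.univ).2 (Set.subset_univ _)]
  exact μ.toOuterMeasure.mono (Set.subset_univ s)

theorem TreeProg.acceptProb_eq_average {Ω : Type*} [Fintype Ω] [Nonempty Ω] {P P' : TreeProg}
    {x : BinTree} {t : ℕ} {h : Ω → BinTree} {T : Ω → ℕ}
    (hrun : run t (P'.init x) = (PMF.uniformOfFintype Ω).bind fun ω => run (T ω) (P.init (h ω))) :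
    P'.acceptProb x t = (∑ ω, P.acceptProb (h ω) (T ω)) / Fintype.card Ω := by
  have hne : ∀ (μ : PMF Cfg) (s : Set Cfg), μ.toOuterMeasure s ≠ ⊤ := fun μ s =>
    ne_top_of_le_ne_top ENNReal.one_ne_top (μ.toOuterMeasure_le_one s)
  rw [acceptProb, hrun, PMF.toOuterMeasure_bind_apply, tsum_fintype, ENNReal.toReal_sum
    (fun ω _ => ENNReal.mul_ne_top (PMF.apply_ne_top _ _) (hne _ _)), Finset.sum_div]
  refine Finset.sum_congr rfl fun ω _ => ?_
  rw [ENNReal.toReal_mul, PMF.uniformOfFintype_apply, ENNReal.toReal_inv, ENNReal.toReal_natCast,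
    acceptProb, div_eq_inv_mul]

theorem TreeProg.acceptProb_nonneg (P : TreeProg) (x : BinTree) (t : ℕ) : 0 ≤ P.acceptProb x t :=
  ENNReal.toReal_nonneg

theorem TreeProg.acceptProb_le_one (P : TreeProg) (x : BinTree) (t : ℕ) :
    P.acceptProb x t ≤ 1 := by
  exact ENNReal.toReal_le_of_le_ofReal zero_le_one (by simpa using PMF.toOuterMeasure_le_one _ _)

/-! ### Deleting the edges that lie on short cycles -/

section Bipartite

variable {m n : ℕ}

/-- The bipartite graph with the edge set `F`. -/
def bipGraph (F : Finset (Fin m × Fin n)) : SimpleGraph (Fin m ⊕ Fin n) :=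
  SimpleGraph.fromRel fun u v => ∃ a b, (a, b) ∈ F ∧ u = Sum.inl a ∧ v = Sum.inr b

@[simp] theorem bipGraph_adj_inl_inr {F : Finset (Fin m × Fin n)} {a : Fin m} {b : Fin n} :
    (bipGraph F).Adj (.inl a) (.inr b) ↔ (a, b) ∈ F := by
  simp [bipGraph]

@[simp] theorem bipGraph_adj_inr_inl {F : Finset (Fin m × Fin n)} {a : Fin m} {b : Fin n} :
    (bipGraph F).Adj (.inr b) (.inl a) ↔ (a, b) ∈ F := by
  simp [bipGraph]

@[simp] theorem not_bipGraph_adj_inl_inl {F : Finset (Fin m × Fin n)} {a a' : Fin m} :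
    ¬ (bipGraph F).Adj (.inl a) (.inl a') := by
  simp [bipGraph]

@[simp] theorem not_bipGraph_adj_inr_inr {F : Finset (Fin m × Fin n)} {b b' : Fin n} :
    ¬ (bipGraph F).Adj (.inr b) (.inr b') := by
  simp [bipGraph]

/-- A set of vertices, together with its neighbours. -/
def spread (F : Finset (Fin m × Fin n)) (S : (Fin m → Bool) × (Fin n → Bool)) :
    (Fin m → Bool) × (Fin n → Bool) :=
  (fun a => S.1 a || decide (∃ b, S.2 b = true ∧ (a, b) ∈ F),
    fun b => S.2 b || decide (∃ a, S.1 a = true ∧ (a, b) ∈ F))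

theorem spread_of_mem {F : Finset (Fin m × Fin n)} {S : (Fin m → Bool) × (Fin n → Bool)}
    {v : Fin m ⊕ Fin n} (h : Sum.elim S.1 S.2 v = true) :
    Sum.elim (spread F S).1 (spread F S).2 v = true := by
  rcases v with a | b <;> simp_all [spread]

theorem spread_of_adj {F : Finset (Fin m × Fin n)} {S : (Fin m → Bool) × (Fin n → Bool)}
    {u v : Fin m ⊕ Fin n} (h : Sum.elim S.1 S.2 u = true) (huv : (bipGraph F).Adj u v) :
    Sum.elim (spread F S).1 (spread F S).2 v = true := by
  rcases u with a | b <;> rcases v with a' | b' <;> simp_all [spread]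
  · exact .inr ⟨a, h, huv⟩
  · exact .inr ⟨b, h, huv⟩

theorem mem_of_spread {F : Finset (Fin m × Fin n)} {S : (Fin m → Bool) × (Fin n → Bool)}
    {v : Fin m ⊕ Fin n} (h : Sum.elim (spread F S).1 (spread F S).2 v = true) :
    Sum.elim S.1 S.2 v = true ∨ ∃ u, Sum.elim S.1 S.2 u = true ∧ (bipGraph F).Adj u v := by
  rcases v with a | b
  · simp only [spread, Sum.elim_inl, Bool.or_eq_true, decide_eq_true_eq] at h
    rcases h with h | ⟨b, h, hF⟩
    · exact .inl h
    · exact .inr ⟨.inr b, h, by simpa using hF⟩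
  · simp only [spread, Sum.elim_inr, Bool.or_eq_true, decide_eq_true_eq] at h
    rcases h with h | ⟨a, h, hF⟩
    · exact .inl h
    · exact .inr ⟨.inl a, h, by simpa using hF⟩

theorem iterate_spread_of_walk {F : Finset (Fin m × Fin n)} {u v : Fin m ⊕ Fin n}
    (w : (bipGraph F).Walk u v) {t : ℕ} (ht : w.length ≤ t)
    {S : (Fin m → Bool) × (Fin n → Bool)} (h : Sum.elim S.1 S.2 u = true) :
    Sum.elim ((spread F)^[t] S).1 ((spread F)^[t] S).2 v = true := by
  induction t generalizing u S with
  | zero =>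
    cases w with
    | nil => exact h
    | cons _ _ => simp at ht
  | succ t ih =>
    rw [Function.iterate_succ_apply]
    cases w with
    | nil => exact ih .nil (by simp) (spread_of_mem h)
    | cons hadj w => exact ih w (by simpa using ht) (spread_of_adj h hadj)

theorem exists_walk_of_iterate_spread {F : Finset (Fin m × Fin n)} {v : Fin m ⊕ Fin n} {t : ℕ}
    {S : (Fin m → Bool) × (Fin n → Bool)}
    (h : Sum.elim ((spread F)^[t] S).1 ((spread F)^[t] S).2 v = true) :
    ∃ u, Sum.elim S.1 S.2 u = true ∧ ∃ w : (bipGraph F).Walk u v, w.length ≤ t := by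
  induction t generalizing v with
  | zero => exact ⟨v, h, .nil, le_rfl⟩
  | succ t ih =>
    rw [Function.iterate_succ_apply'] at h
    rcases mem_of_spread h with h | ⟨v', h, hadj⟩
    · obtain ⟨u, hu, w, hw⟩ := ih h
      exact ⟨u, hu, w, by omega⟩
    · obtain ⟨u, hu, w, hw⟩ := ih h
      exact ⟨u, hu, w.concat hadj, by simpa using hw⟩

/-- Whether the ends of `e` are joined by a walk of length at most `t` that avoids `e`. -/
def joined (F : Finset (Fin m × Fin n)) (t : ℕ) (e : Fin m × Fin n) : Bool :=
  ((spread (F.erase e))^[t] (fun a => decide (e.1 = a), fun _ => false)).2 e.2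

/-- For `e ∈ F` such a walk means that `e` lies on a cycle of length at most `t + 1`, which explains
the argument `k - 1` in `highGirth`. -/
theorem joined_iff {F : Finset (Fin m × Fin n)} {t : ℕ} {e : Fin m × Fin n} :
    joined F t e = true ↔
      ∃ w : (bipGraph (F.erase e)).Walk (.inl e.1) (.inr e.2), w.length ≤ t := by
  refine ⟨fun h => ?_, fun ⟨w, hw⟩ => ?_⟩
  · obtain ⟨u, hu, w, hw⟩ := exists_walk_of_iterate_spread (v := .inr e.2) h
    rcases u with a | b
    · simp only [Sum.elim_inl, decide_eq_true_eq] at hu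
      subst hu
      exact ⟨w, hw⟩
    · simp at hu
  · exact iterate_spread_of_walk w hw
      (S := (fun a => decide (e.1 = a), fun _ => false)) (by simp)

/-- The edges that are on no cycle of length at most `k`. -/
def highGirth (F : Finset (Fin m × Fin n)) (k : ℕ) : Finset (Fin m × Fin n) :=
  F.filter fun e => joined F (k - 1) e = false

theorem mem_edgeSet_bipGraph {F : Finset (Fin m × Fin n)} {z : Sym2 (Fin m ⊕ Fin n)} :
    z ∈ (bipGraph F).edgeSet ↔ ∃ f ∈ F, z = s(.inl f.1, .inr f.2) := by
  induction z with
  | _ u v =>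
    rcases u with a | b <;> rcases v with a' | b' <;> simp

/-- A short cycle of the remaining graph is also a short cycle of the graph of `F`, so its first
edge would have been deleted. -/
theorem lt_egirth_highGirth (F : Finset (Fin m × Fin n)) (k : ℕ) :
    (k : ℕ∞) < (bipGraph (highGirth F k)).egirth := by
  have key : ∀ (a : Fin m) (b : Fin n) (w : (bipGraph (highGirth F k)).Walk (.inl a) (.inr b)),
      s(.inl a, .inr b) ∉ w.edges → (a, b) ∈ highGirth F k → k ≤ w.length := by
    intro a b w hw hab
    by_contra! hlt
    have hj : joined F (k - 1) (a, b) = true := by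
      rw [joined_iff]
      refine ⟨w.transfer _ fun z hz => ?_, ?_⟩
      · obtain ⟨f, hf, rfl⟩ := mem_edgeSet_bipGraph.1 (w.edges_subset_edgeSet hz)
        refine mem_edgeSet_bipGraph.2 ⟨f, ?_, rfl⟩
        refine Finset.mem_erase.2 ⟨?_, (Finset.mem_filter.1 hf).1⟩
        rintro rfl
        exact hw hz
      · rw [SimpleGraph.Walk.length_transfer]
        omega
    have := (Finset.mem_filter.1 hab).2
    rw [hj] at this
    exact absurd this (by simp)
  rw [← ENat.add_one_le_iff (ENat.natCast_ne_top k), SimpleGraph.le_egirth]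
  intro u c hc
  norm_cast
  cases c with
  | nil => exact absurd hc (by simp)
  | cons hadj w =>
    rename_i v
    rw [SimpleGraph.Walk.cons_isCycle_iff] at hc
    rw [SimpleGraph.Walk.length_cons]
    refine Nat.succ_le_succ ?_
    rcases u with a | b <;> rcases v with a' | b'
    · simp at hadj
    · rw [← SimpleGraph.Walk.length_reverse]
      exact key a b' w.reverse (by simpa using hc.2) (by simpa using hadj)
    · refine key a' b w ?_ (by simpa using hadj)
      rw [Sym2.eq_swap]
      exact hc.2
    · simp at hadj

end Bipartite

/-! ### The reduction on instances -/

namespace LabelCover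

/-- The instance with fewer edges. -/
def restrict (I : LabelCover) (F : Finset (Fin I.nA × Fin I.nB)) (hF : F ⊆ I.E) : LabelCover :=
  { I with E := F, rel_nonempty := fun e he => I.rel_nonempty e (hF he) }

/-- The edges all of whose coins show `true`. -/
def kept (I : LabelCover) {j : ℕ} (ω : Fin I.nA → Fin I.nB → Fin j → Bool) :
    Finset (Fin I.nA × Fin I.nB) :=
  I.E.filter fun e => ∀ i, ω e.1 e.2 i = true

theorem highGirth_kept_subset (I : LabelCover) {j : ℕ} (ω : Fin I.nA → Fin I.nB → Fin j → Bool)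
    (k : ℕ) : highGirth (I.kept ω) k ⊆ I.E :=
  (Finset.filter_subset _ _).trans (Finset.filter_subset _ _)

/-- The instance that remains when only the edges whose coins all show `true` are kept and then
those on cycles of length at most `k` are deleted. -/
def sparsify (I : LabelCover) {j : ℕ} (ω : Fin I.nA → Fin I.nB → Fin j → Bool) (k : ℕ) :
    LabelCover := I.restrict (highGirth (I.kept ω) k) (I.highGirth_kept_subset ω k)

open Classical in
/-- The entry of the matrix that encodes an instance. -/
noncomputable def entry (I : LabelCover) (F : Finset (Fin I.nA × Fin I.nB)) (a : Fin I.nA)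
    (b : Fin I.nB) : BinTree :=
  if (a, b) ∈ F then
    BinTree.ofList ((List.finRange I.qA).map fun x =>
      BinTree.ofList ((List.finRange I.qB).map fun y =>
        BinTree.ofBool (decide ((x, y) ∈ I.rel (a, b)))))
  else BinTree.nil

/-- The matrix that encodes an instance with the edges in `F`. -/
noncomputable def matrix (I : LabelCover) (F : Finset (Fin I.nA × Fin I.nB)) : BinTree :=
  .ofList ((List.finRange I.nA).map fun a => .ofList ((List.finRange I.nB).map fun b =>
    I.entry F a b))

theorem encode_restrict (I : LabelCover) (F : Finset (Fin I.nA × Fin I.nB)) (hF : F ⊆ I.E) :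
    (I.restrict F hF).encode = .ofList [.ofNat I.nA, .ofNat I.nB, .ofNat I.qA, .ofNat I.qB,
      I.matrix F] := rfl

theorem encode_eq (I : LabelCover) :
    I.encode = .ofList [.ofNat I.nA, .ofNat I.nB, .ofNat I.qA, .ofNat I.qB, I.matrix I.E] := rfl

/-- A nonempty relation forces `qA` to be positive, so the truth table of an edge is a nonempty list
and differs from the `nil` of a non-edge. -/
theorem toBool_entry (I : LabelCover) {F : Finset (Fin I.nA × Fin I.nB)} (hF : F ⊆ I.E)
    (a : Fin I.nA) (b : Fin I.nB) : (I.entry F a b).toBool = decide ((a, b) ∈ F) := by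
  rw [entry]
  split_ifs with h
  · obtain ⟨⟨x, y⟩, -⟩ := I.rel_nonempty _ (hF h)
    have : I.qA ≠ 0 := fun h0 => by have := x.2; omega
    obtain ⟨q, hq⟩ := Nat.exists_eq_succ_of_ne_zero this
    rw [decide_eq_true h]
    have h1 : List.finRange I.qA ≠ [] := by simpa using this
    obtain ⟨c, l, hl⟩ := List.exists_cons_of_ne_nil h1
    rw [hl]
    simp
  · simp [h]

end LabelCover

/-! ### The reduction on trees -/

namespace BinTree

/-- Whether `(a', b')` is an edge of the graph with matrix `M` other than `(a, b)`. -/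
def adjT (M a b a' b' : BinTree) : Bool :=
  ((M.get a').get b').toBool && !(natEq a a' && natEq b b')

/-- One step of the search for the vertices that are close to `a`. -/
def spreadT (M u v a b S : BinTree) : BinTree :=
  cons (tab u.len fun i => ofBool ((S.hd.get i).toBool ||
      ex v.len fun j => (S.tl.get j).toBool && adjT M a b i j))
    (tab v.len fun j => ofBool ((S.tl.get j).toBool ||
      ex u.len fun i => (S.hd.get i).toBool && adjT M a b i j))

/-- Whether `a` and `b` are joined by a short walk that avoids the edge `(a, b)`. -/
def joinedT (M u v t a b : BinTree) : Bool :=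
  (((spreadT M u v a b)^[t.len]
    (cons (tab u.len fun i => ofBool (natEq a i)) (tab v.len fun _ => nil))).tl.get b).toBool

/-- The matrix without the edges on short cycles. -/
def highGirthT (M u v t : BinTree) : BinTree :=
  tab u.len fun a => tab v.len fun b => if joinedT M u v t a b = true then nil else (M.get a).get b

/-- The matrix restricted to the entries all of whose coins show `true`. -/
def keptT (C M u v : BinTree) : BinTree :=
  tab u.len fun a => tab v.len fun b =>
    if ((C.get a).get b).toList.all toBool = true then (M.get a).get b else nil

/-- The reduction, with the coins `C`, on an instance with the encoding `x`. -/
def reduceT (C x k : BinTree) : BinTree :=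
  cons x.hd <| cons x.tl.hd <| cons x.tl.tl.hd <| cons x.tl.tl.tl.hd <|
    cons (highGirthT (keptT C x.tl.tl.tl.tl.hd x.hd x.tl.hd) x.hd x.tl.hd k.tl) nil

end BinTree

namespace PolyTime

open BinTree

section

variable {M u v t a b a' b' S C x k : BinTree → BinTree}

theorem adjT (hM : PolyTime M) (ha : PolyTime a) (hb : PolyTime b) (ha' : PolyTime a')
    (hb' : PolyTime b') : PolyTime fun y => ofBool (adjT (M y) (a y) (b y) (a' y) (b' y)) :=
  ((hM.get ha').get hb').toBool.and ((ha.natEq ha').and (hb.natEq hb')).not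

theorem spreadT (hM : PolyTime M) (hu : PolyTime u) (hv : PolyTime v) (ha : PolyTime a)
    (hb : PolyTime b) (hS : PolyTime S) :
    PolyTime fun y => spreadT (M y) (u y) (v y) (a y) (b y) (S y) := by
  have h1 : ∀ {f : BinTree → BinTree}, PolyTime f → PolyTime fun y => f y.tl :=
    fun h => h.comp tl
  refine cons (table (F := fun y i => ofBool (((S y).hd.get i).toBool || ex (v y).len fun j =>
      ((S y).tl.get j).toBool && BinTree.adjT (M y) (a y) (b y) i j)) ?_ hu)
    (table (F := fun y j => ofBool (((S y).tl.get j).toBool || ex (u y).len fun i =>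
      ((S y).hd.get i).toBool && BinTree.adjT (M y) (a y) (b y) i j)) ?_ hv)
  · refine ((h1 hS).hd'.get hd).toBool.or (exists_fin (p := fun y j =>
      ((S y.tl).tl.get j).toBool && BinTree.adjT (M y.tl) (a y.tl) (b y.tl) y.hd j) ?_ (h1 hv))
    exact ((h1 (h1 hS)).tl'.get hd).toBool.and
      (adjT (h1 (h1 hM)) (h1 (h1 ha)) (h1 (h1 hb)) (h1 hd) hd)
  · refine ((h1 hS).tl'.get hd).toBool.or (exists_fin (p := fun y i =>
      ((S y.tl).hd.get i).toBool && BinTree.adjT (M y.tl) (a y.tl) (b y.tl) i y.hd) ?_ (h1 hu))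
    exact ((h1 (h1 hS)).hd'.get hd).toBool.and
      (adjT (h1 (h1 hM)) (h1 (h1 ha)) (h1 (h1 hb)) hd (h1 hd))

theorem joinedT (hM : PolyTime M) (hu : PolyTime u) (hv : PolyTime v) (ht : PolyTime t)
    (ha : PolyTime a) (hb : PolyTime b) :
    PolyTime fun y => ofBool (joinedT (M y) (u y) (v y) (t y) (a y) (b y)) := by
  have h1 : ∀ {f : BinTree → BinTree}, PolyTime f → PolyTime fun y => f y.tl :=
    fun h => h.comp tl
  have h0 : PolyTime fun y => .cons (tab (u y).len fun i => ofBool (BinTree.natEq (a y) i))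
      (tab (v y).len fun _ => .nil) :=
    (table (F := fun y i => ofBool (BinTree.natEq (a y) i)) ((h1 ha).natEq hd) hu).cons
      (table (F := fun _ _ => .nil) nil hv)
  refine ((iterate (F := fun y => BinTree.spreadT (M y) (u y) (v y) (a y) (b y))
    (spreadT (h1 hM) (h1 hu) (h1 hv) (h1 ha) (h1 hb) hd) ht h0 ?_).tl'.get hb).toBool
  obtain ⟨_, q, hq⟩ := hu
  obtain ⟨_, r, hr⟩ := hv
  -- Every iterate is a pair of tables of truth values, each of size at most 3, so its size does not
  -- depend on the number of rounds.
  refine ⟨q * 4 + r * 4 + 3, fun y m _ => ?_⟩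
  have hB : ∀ f : BinTree → BinTree, ∀ n N, n ≤ N → (∀ e, (f e).size ≤ 3) →
      (tab n f).size ≤ N * 4 + 1 := fun f n N hn h =>
    (size_tab_le h).trans (by have := Nat.mul_le_mul_right 4 hn; omega)
  have h2 := (u y).len_le_size.trans (hq y).1
  have h3 := (v y).len_le_size.trans (hr y).1
  simp only [Polynomial.eval_add, Polynomial.eval_mul, Polynomial.eval_ofNat]
  cases m with
  | zero =>
    have h4 := hB (fun i => ofBool (BinTree.natEq (a y) i)) _ _ h2 fun _ => size_ofBool_le _
    have h5 := hB (fun _ => .nil) _ _ h3 fun _ => by simp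
    simp only [Function.iterate_zero, id_eq, size_cons]
    omega
  | succ m =>
    rw [Function.iterate_succ_apply', BinTree.spreadT, size_cons]
    refine (Nat.add_le_add_right (Nat.add_le_add (hB _ _ _ h2 fun _ => size_ofBool_le _)
      (hB _ _ _ h3 fun _ => size_ofBool_le _)) 1).trans ?_
    omega

theorem highGirthT (hM : PolyTime M) (hu : PolyTime u) (hv : PolyTime v) (ht : PolyTime t) :
    PolyTime fun y => highGirthT (M y) (u y) (v y) (t y) := by
  have h1 : ∀ {f : BinTree → BinTree}, PolyTime f → PolyTime fun y => f y.tl :=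
    fun h => h.comp tl
  refine table (F := fun y a => tab (v y).len fun b =>
    if BinTree.joinedT (M y) (u y) (v y) (t y) a b = true then .nil else ((M y).get a).get b)
    (table (F := fun y b => if BinTree.joinedT (M y.tl) (u y.tl) (v y.tl) (t y.tl) y.hd b = true
      then .nil else ((M y.tl).get y.hd).get b) ?_ (h1 hv)) hu
  exact ite (joinedT (h1 (h1 hM)) (h1 (h1 hu)) (h1 (h1 hv)) (h1 (h1 ht)) (h1 hd) hd) nil
    (((h1 (h1 hM)).get (h1 hd)).get hd)

theorem keptT (hC : PolyTime C) (hM : PolyTime M) (hu : PolyTime u) (hv : PolyTime v) :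
    PolyTime fun y => keptT (C y) (M y) (u y) (v y) := by
  have h1 : ∀ {f : BinTree → BinTree}, PolyTime f → PolyTime fun y => f y.tl :=
    fun h => h.comp tl
  refine table (F := fun y a => tab (v y).len fun b =>
    if (((C y).get a).get b).toList.all BinTree.toBool = true then ((M y).get a).get b else .nil)
    (table (F := fun y b => if (((C y.tl).get y.hd).get b).toList.all BinTree.toBool = true
      then ((M y.tl).get y.hd).get b else .nil) ?_ (h1 hv)) hu
  exact ite (all (p := fun _ e => e.toBool) hd.toBool (((h1 (h1 hC)).get (h1 hd)).get hd))
    (((h1 (h1 hM)).get (h1 hd)).get hd) nil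

theorem reduceT (hC : PolyTime C) (hx : PolyTime x) (hk : PolyTime k) :
    PolyTime fun y => reduceT (C y) (x y) (k y) :=
  hx.hd'.cons <| hx.tl'.hd'.cons <| hx.tl'.tl'.hd'.cons <| hx.tl'.tl'.tl'.hd'.cons <|
    cons (highGirthT (keptT hC hx.tl'.tl'.tl'.tl'.hd' hx.hd' hx.tl'.hd') hx.hd' hx.tl'.hd' hk.tl')
      nil

end

end PolyTime

namespace LabelCover

open BinTree

/-- The tables that represent a set of vertices. -/
def vertexTables {m n : ℕ} (S : (Fin m → Bool) × (Fin n → Bool)) : BinTree :=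
  .cons (.ofList ((List.finRange m).map fun a => ofBool (S.1 a)))
    (.ofList ((List.finRange n).map fun b => ofBool (S.2 b)))

/-- The list of lists of coins. -/
def coinTables {m n j : ℕ} (ω : Fin m → Fin n → Fin j → Bool) : BinTree :=
  .ofList ((List.finRange m).map fun a => .ofList ((List.finRange n).map fun b =>
    .ofList ((List.finRange j).map fun i => ofBool (ω a b i))))

variable (I : LabelCover) {F : Finset (Fin I.nA × Fin I.nB)}

theorem get_get_matrix (a : Fin I.nA) (b : Fin I.nB) :
    ((I.matrix F).get (ofNat a)).get (ofNat b) = I.entry F a b := by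
  rw [matrix, get_table, get_table]

theorem adjT_matrix (hF : F ⊆ I.E) (a a' : Fin I.nA) (b b' : Fin I.nB) :
    adjT (I.matrix F) (ofNat a) (ofNat b) (ofNat a') (ofNat b') =
      decide ((a', b') ∈ F.erase (a, b)) := by
  rw [adjT, get_get_matrix, toBool_entry I hF, natEq_ofNat, natEq_ofNat, Bool.eq_iff_iff]
  simp only [Bool.and_eq_true, Bool.not_eq_true', Bool.and_eq_false_iff, decide_eq_true_eq,
    decide_eq_false_iff_not, Finset.mem_erase, ne_eq, Prod.mk.injEq, Fin.val_inj]
  grind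

theorem spreadT_matrix (hF : F ⊆ I.E) (a : Fin I.nA) (b : Fin I.nB)
    (S : (Fin I.nA → Bool) × (Fin I.nB → Bool)) :
    spreadT (I.matrix F) (ofNat I.nA) (ofNat I.nB) (ofNat a) (ofNat b) (vertexTables S) =
      vertexTables (spread (F.erase (a, b)) S) := by
  rw [spreadT, vertexTables, vertexTables, len_ofNat, len_ofNat]
  congr 1
  · refine tab_eq fun i => ?_
    simp only [hd_cons, tl_cons, get_table, toBool_ofBool, spread, ex, adjT_matrix I hF,
      Bool.and_eq_true, decide_eq_true_eq]
  · refine tab_eq fun i => ?_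
    simp only [hd_cons, tl_cons, get_table, toBool_ofBool, spread, ex, adjT_matrix I hF,
      Bool.and_eq_true, decide_eq_true_eq]

theorem joinedT_matrix (hF : F ⊆ I.E) (t : ℕ) (a : Fin I.nA) (b : Fin I.nB) :
    joinedT (I.matrix F) (ofNat I.nA) (ofNat I.nB) (ofNat t) (ofNat a) (ofNat b) =
      joined F t (a, b) := by
  have h0 : BinTree.cons (tab (ofNat I.nA).len fun i => ofBool (natEq (ofNat a) i))
      (tab (ofNat I.nB).len fun _ => .nil) =
      vertexTables (fun a' : Fin I.nA => decide (a = a'), fun _ : Fin I.nB => false) := by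
    rw [vertexTables, len_ofNat, len_ofNat]
    congr 1
    · exact tab_eq fun i => by simp [Fin.val_inj]
  have hit : ∀ S, (spreadT (I.matrix F) (ofNat I.nA) (ofNat I.nB) (ofNat a) (ofNat b))^[t]
      (vertexTables S) = vertexTables ((spread (F.erase (a, b)))^[t] S) := by
    intro S
    induction t generalizing S with
    | zero => rfl
    | succ t ih => rw [Function.iterate_succ_apply, Function.iterate_succ_apply,
        spreadT_matrix I hF, ih]
  rw [joinedT, h0, len_ofNat, hit, vertexTables, tl_cons, get_table, toBool_ofBool, joined]

theorem highGirthT_matrix (hF : F ⊆ I.E) (k : ℕ) :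
    highGirthT (I.matrix F) (ofNat I.nA) (ofNat I.nB) (ofNat (k - 1)) =
      I.matrix (highGirth F k) := by
  rw [highGirthT, len_ofNat, len_ofNat]
  conv_rhs => rw [matrix]
  refine tab_eq fun a => tab_eq fun b => ?_
  rw [joinedT_matrix I hF, get_get_matrix, entry, entry]
  simp only [highGirth, Finset.mem_filter]
  by_cases h1 : (a, b) ∈ F <;> cases joined F (k - 1) (a, b) <;> simp [h1]

theorem keptT_matrix {j : ℕ} (ω : Fin I.nA → Fin I.nB → Fin j → Bool) :
    keptT (coinTables ω) (I.matrix I.E) (ofNat I.nA) (ofNat I.nB) = I.matrix (I.kept ω) := by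
  rw [keptT, len_ofNat, len_ofNat]
  conv_rhs => rw [matrix]
  refine tab_eq fun a => tab_eq fun b => ?_
  rw [get_get_matrix, coinTables, get_table, get_table, toList_ofList, entry, entry]
  have : (((List.finRange j).map fun i => ofBool (ω a b i)).all toBool = true) ↔
      ∀ i, ω a b i = true := by simp
  simp only [this, kept, Finset.mem_filter]
  by_cases h1 : (a, b) ∈ I.E <;> by_cases h2 : ∀ i, ω a b i = true <;> simp [h1, h2]

theorem reduceT_encode {j : ℕ} (ω : Fin I.nA → Fin I.nB → Fin j → Bool) (k : ℕ) :
    reduceT (coinTables ω) I.encode (ofNat k) = (I.sparsify ω k).encode := by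
  -- For `k = 0` this holds because the tail of `nil` is `nil`, in accordance with truncated
  -- subtraction.
  have hk : (ofNat k).tl = ofNat (k - 1) := by cases k <;> rfl
  rw [sparsify, encode_restrict, encode_eq]
  simp only [reduceT, ofList_cons, ofList_nil, hd_cons, tl_cons, hk, keptT_matrix]
  rw [highGirthT_matrix I (F := I.kept ω) (Finset.filter_subset _ _)]

end LabelCover

/-! ### The number of coins -/

/-- The number of coins for every edge, on graphs of degree `d`. -/
def coinCount (d k : ℕ) : ℕ :=
  (List.range d).countP (fun t => decide (d / 2 ^ t ≠ 0)) -
    (List.range d).countP fun i => decide (d / 2 ^ (k * (i + 1)) ≠ 0)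

theorem countP_range_of_lt {p : ℕ → Bool} {m n : ℕ} (hmn : m ≤ n)
    (h : ∀ i < n, p i = true ↔ i < m) : (List.range n).countP p = m := by
  have h1 : (List.range n).countP p = ((Finset.range n).filter fun i => p i = true).card := by
    rw [Finset.card_def, Finset.filter_val, Finset.range_val, Multiset.range, Multiset.filter_coe,
      Multiset.coe_card, List.countP_eq_length_filter]
    simp
  rw [h1]
  have : ((Finset.range n).filter fun i => p i = true) = Finset.range m := by
    ext i
    simp only [Finset.mem_filter, Finset.mem_range]
    constructor
    · rintro ⟨h2, h3⟩; exact (h i h2).1 h3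
    · intro h2; exact ⟨by omega, (h i (by omega)).2 h2⟩
  rw [this, Finset.card_range]

/-- Since d / 2^t ≠ 0 means t ≤ log d, counting such t gives the logarithm plus one; counting
multiples k (i + 1) in the same way gives its quotient by k. The definition thus needs nothing but
repeated halving of unary numbers. -/
theorem coinCount_eq {d k : ℕ} (hd : 1 ≤ d) (hk : 1 ≤ k) :
    coinCount d k = Nat.log 2 d + 1 - Nat.log 2 d / k := by
  have hlog : Nat.log 2 d < d := Nat.log_lt_self 2 (by omega)
  have h1 : ∀ t, d / 2 ^ t ≠ 0 ↔ t ≤ Nat.log 2 d := fun t => by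
    rw [ne_eq, Nat.div_eq_zero_iff, Nat.le_log_iff_pow_le (by norm_num) (by omega)]
    simp
  rw [coinCount, countP_range_of_lt (m := Nat.log 2 d + 1) (by omega),
    countP_range_of_lt (m := Nat.log 2 d / k)]
  · exact (Nat.div_le_self _ _).trans hlog.le
  · intro i _
    rw [decide_eq_true_eq, h1, Nat.lt_iff_add_one_le, Nat.le_div_iff_mul_le (by omega), mul_comm]
  · intro i _
    rw [decide_eq_true_eq, h1, Nat.lt_iff_add_one_le]; omega

namespace PolyTime

open BinTree

theorem iterate_half {c f : BinTree → BinTree} (hc : PolyTime c) (hf : PolyTime f) :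
    PolyTime fun x => BinTree.half^[(c x).len] (f x) := by
  refine iterate (F := fun _ => BinTree.half) (half.comp hd) hc hf ?_
  obtain ⟨_, q, hq⟩ := hf
  refine ⟨q, fun x m _ => ?_⟩
  induction m with
  | zero => exact (hq x).1
  | succ m ih =>
    rw [Function.iterate_succ_apply', half_eq, size_ofNat]
    have h1 := (BinTree.half^[m] (f x)).len_le_size
    have h2 : ∀ t : BinTree, 2 * t.len + 1 ≤ t.size := by
      intro t
      induction t with
      | nil => simp
      | cons a b _ ih => have := a.one_le_size; simp only [len_cons, size_cons]; omega
    have h3 := h2 (BinTree.half^[m] (f x))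
    have h4 := ih (by omega)
    omega

theorem coinCount {c f : BinTree → BinTree} (hf : PolyTime f) (hc : PolyTime c) :
    PolyTime fun x => ofNat (coinCount (f x).len (c x).len) := by
  have h1 : ∀ {f : BinTree → BinTree}, PolyTime f → PolyTime fun y => f y.tl :=
    fun h => h.comp tl
  have hN := hf.ofNat_len
  have e1 : PolyTime fun x => ofNat ((List.range (f x).len).countP
      fun t => decide ((f x).len / 2 ^ t ≠ 0)) := by
    convert countP (p := fun x e => (BinTree.half^[e.len] (ofNat (f x).len)).toBool)
      (iterate_half hd (h1 hN)).toBool hf.range with x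
    rw [toList_ofList, List.countP_map]
    congr 1
    funext t
    simp only [Function.comp, len_ofNat, iterate_half_ofNat, toBool_ofNat]
  have e2 : PolyTime fun x => ofNat ((List.range (f x).len).countP
      fun t => decide ((f x).len / 2 ^ ((c x).len * (t + 1)) ≠ 0)) := by
    convert countP (p := fun x e => (((fun y => BinTree.half^[(c x).len] y)^[(BinTree.cons .nil e).len]
      (ofNat (f x).len))).toBool) (PolyTime.toBool ?_) hf.range with x
    · rw [toList_ofList, List.countP_map]
      congr 1
      funext t
      simp only [Function.comp, len_cons, len_ofNat]
      rw [show (fun y => BinTree.half^[(c x).len] y) = BinTree.half^[(c x).len] from rfl,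
        ← Function.iterate_mul, iterate_half_ofNat, toBool_ofNat]
    · refine iterate (F := fun y z => BinTree.half^[(c y.tl).len] z)
        (c := fun y => BinTree.cons .nil y.hd) (a := fun y => ofNat (f y.tl).len)
        (iterate_half (h1 (h1 hc)) hd) (nil.cons hd) (h1 hN) ?_
      obtain ⟨_, q, hq⟩ := h1 hN
      refine ⟨q, fun x m _ => ?_⟩
      rw [show (fun y => BinTree.half^[(c x.tl).len] y) = BinTree.half^[(c x.tl).len] from rfl,
        ← Function.iterate_mul, iterate_half_ofNat]
      refine le_trans ?_ (hq x).1
      rw [size_ofNat, size_ofNat]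
      have := Nat.div_le_self (f x.tl).len (2 ^ ((c x.tl).len * m))
      omega
  convert iterate_tl e1 e2 with x
  rw [len_ofNat, iterate_tl_ofNat, _root_.coinCount]

end PolyTime

/-! ### The randomized reduction -/

namespace LabelCover

open BinTree

/-- The degree of the first vertex. -/
noncomputable def firstDegree (I : LabelCover) : ℕ := (I.matrix I.E).hd.toList.countP toBool

/-- The reduction learns the degree from the instance, so the function d need not be computable. -/
theorem Regular.firstDegree_eq {I : LabelCover} {d : ℕ} (h : I.Regular d) (hI : 0 < I.nA) :
    I.firstDegree = d := by
  obtain ⟨m, hm⟩ := Nat.exists_eq_succ_of_ne_zero hI.ne'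
  have h1 : (I.matrix I.E).hd = .ofList ((List.finRange I.nB).map fun b => I.entry I.E ⟨0, hI⟩ b) := by
    rw [matrix]
    have h2 : List.finRange I.nA = ⟨0, hI⟩ :: (List.finRange I.nA).tail := by
      apply List.ext_getElem
      · simp; omega
      · intro i h3 h4
        rcases i with _ | i <;> simp
    rw [h2]
    simp
  rw [firstDegree, h1, toList_ofList, List.countP_map, ← h.1 ⟨0, hI⟩]
  have h3 : (toBool ∘ fun b => I.entry I.E ⟨0, hI⟩ b) = fun b => decide ((⟨0, hI⟩, b) ∈ I.E) := by
    funext b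
    exact toBool_entry I subset_rfl _ _
  rw [h3]
  have h4 : (List.finRange I.nB).countP (fun b => decide ((⟨0, hI⟩, b) ∈ I.E)) =
      (Finset.univ.filter fun b : Fin I.nB => (⟨0, hI⟩, b) ∈ I.E).card := by
    rw [List.countP_eq_length_filter, ← Multiset.coe_card, ← Multiset.filter_coe]
    simp [Finset.card_def]
    rfl
  rw [h4]
  refine Finset.card_bij (fun b _ => (⟨0, hI⟩, b)) ?_ ?_ ?_
  · intro b hb; simpa using hb
  · intro b _ b' _ h; simpa using h
  · rintro ⟨a, b⟩ hab
    simp only [Finset.mem_filter] at hab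
    obtain ⟨hab, rfl⟩ := hab
    exact ⟨b, by simpa using hab, rfl⟩

/-- The number of coins that the reduction tosses for every edge. -/
noncomputable def coins (I : LabelCover) (k : ℕ → ℕ) : ℕ :=
  coinCount I.firstDegree (k I.numVertices)

/-- Holds for all instances, regular or not: sparsifying always yields a genuine instance, on which
`P` halts in time, and so `P'` halts in time on every input. -/
theorem exists_reduction {k : ℕ → ℕ} (hk : PolyTimeComputable k) (P : TreeProg) (p : Polynomial ℕ)
    (hP : ∀ I : LabelCover, P.HaltsWithin I.encode (p.eval I.encode.size)) :
    ∃ (P' : TreeProg) (p' : Polynomial ℕ), ∀ I : LabelCover,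
      P'.HaltsWithin I.encode (p'.eval I.encode.size) ∧
      P'.acceptProb I.encode (p'.eval I.encode.size) =
        (∑ ω : Fin I.nA → Fin I.nB → Fin (I.coins k) → Bool,
          P.acceptProb (I.sparsify ω (k I.numVertices)).encode
            (p.eval (I.sparsify ω (k I.numVertices)).encode.size)) /
          Fintype.card (Fin I.nA → Fin I.nB → Fin (I.coins k) → Bool) := by
  have hA : PolyTime fun x => x.hd := PolyTime.hd
  have hB : PolyTime fun x => x.tl.hd := PolyTime.tl.hd'
  -- The number of vertices `nA + nB` in unary, the argument at which `k` is evaluated.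
  have hn : PolyTime fun x => (BinTree.cons .nil)^[x.hd.len] x.tl.hd := by
    refine PolyTime.iterate (F := fun _ => BinTree.cons .nil) (.cons .nil .hd) hA hB
      ⟨.X + 2 * .X, fun x m hm => ?_⟩
    have h1 : ((BinTree.cons .nil)^[m] x.tl.hd).size = x.tl.hd.size + 2 * m := by
      clear hm
      induction m with
      | zero => simp
      | succ m ih => rw [Function.iterate_succ_apply', size_cons, ih, size_nil]; omega
    have h2 := x.hd.len_le_size.trans x.size_hd_le
    have h3 := x.tl.size_hd_le.trans x.size_tl_le
    simp only [Polynomial.eval_add, Polynomial.eval_mul, Polynomial.eval_X,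
      Polynomial.eval_ofNat]
    omega
  have hK := hk.polyTime.comp hn
  have hD : PolyTime fun x => ofNat (x.tl.tl.tl.tl.hd.hd.toList.countP toBool) :=
    PolyTime.countP (p := fun _ e => e.toBool) PolyTime.hd.toBool
      PolyTime.tl.tl'.tl'.tl'.hd'.hd'
  -- The three sizes for the nested coin tosses, followed by the data that have to survive the
  -- tossing.
  have hpre := (hA.cons (hB.cons ((PolyTime.coinCount hD hK).cons .nil))).cons
    (PolyTime.id.cons hK)
  have hg := RandTime.coin.rep.rep.rep.pair.comp hpre
  obtain ⟨P', p', h⟩ := hg.exists_treeProg (G := fun y => reduceT y.hd y.tl.hd y.tl.tl)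
    (PolyTime.reduceT .hd PolyTime.tl.hd' PolyTime.tl.tl') P p
  refine ⟨P', p', fun I => ?_⟩
  have hlen : ((BinTree.cons .nil)^[I.nA] (ofNat I.nB)).len = I.numVertices := by
    have : ∀ m : ℕ, ((BinTree.cons .nil)^[m] (ofNat I.nB)).len = m + I.nB := by
      intro m
      induction m with
      | zero => simp
      | succ m ih => rw [Function.iterate_succ_apply', len_cons, ih]; omega
    exact this _
  have hpmf := h I.encode
  have e1 : ∀ n (ω : Fin n → Bool), BinTree.ofList ((List.finRange n).map
      (fun i => ofBool (ω i)) ++ []) = .ofList ((List.finRange n).map fun i => ofBool (ω i)) :=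
    fun n ω => by rw [List.append_nil]
  have hmap : ∀ m n j : ℕ, ((((PMF.uniformOfFintype Bool).map ofBool).rep j .nil).rep n .nil).rep
      m .nil = (PMF.uniformOfFintype (Fin m → Fin n → Fin j → Bool)).map coinTables := by
    intro m n j
    rw [← ofList_nil, PMF.rep_map_uniformOfFintype, PMF.rep_map_uniformOfFintype,
      PMF.rep_map_uniformOfFintype]
    simp only [List.append_nil]
    rfl
  have hx : I.encode.hd = ofNat I.nA ∧ I.encode.tl.hd = ofNat I.nB ∧
      I.encode.tl.tl.tl.tl.hd = I.matrix I.E := by simp [encode_eq]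
  simp only [hx, hd_cons, tl_cons, len_ofNat, hlen, hmap, PMF.map_comp, PMF.bind_map] at hpmf
  have hsup : ∀ y ∈ (PMF.map ((fun y => y.cons (I.encode.cons (ofNat (k I.numVertices)))) ∘
      coinTables) (PMF.uniformOfFintype (Fin I.nA → Fin I.nB → Fin (I.coins k) → Bool))).support,
      P.HaltsWithin (reduceT y.hd y.tl.hd y.tl.tl)
        (p.eval (reduceT y.hd y.tl.hd y.tl.tl).size) := by
    intro y hy
    rw [PMF.mem_support_map_iff] at hy
    obtain ⟨ω, -, rfl⟩ := hy
    simp only [Function.comp, hd_cons, tl_cons, reduceT_encode]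
    exact hP _
  replace hpmf := hpmf hsup
  simp only [Function.comp_def, hd_cons, tl_cons] at hpmf
  have hrun : run (p'.eval I.encode.size) (P'.init I.encode) =
      (PMF.uniformOfFintype (Fin I.nA → Fin I.nB → Fin (I.coins k) → Bool)).bind fun ω =>
        run (p.eval (I.sparsify ω (k I.numVertices)).encode.size)
          (P.init (I.sparsify ω (k I.numVertices)).encode) := by
    simp only [← reduceT_encode]
    exact hpmf
  refine ⟨fun c hc => ?_, TreeProg.acceptProb_eq_average hrun⟩
  rw [hrun, PMF.mem_support_bind_iff] at hc
  obtain ⟨ω, -, hc⟩ := hc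
  exact hP _ c hc

end LabelCover

/-! ### Averages over independent coins -/

section Average

variable {Ω : Type*} [Fintype Ω]

/-- The average of a function on a finite probability space with the uniform distribution. -/
noncomputable def avg (f : Ω → ℝ) : ℝ := (∑ ω, f ω) / Fintype.card Ω

theorem avg_mono {f g : Ω → ℝ} (h : ∀ ω, f ω ≤ g ω) : avg f ≤ avg g :=
  div_le_div_of_nonneg_right (Finset.sum_le_sum fun ω _ => h ω) (Nat.cast_nonneg _)

theorem avg_sum {ι : Type*} (s : Finset ι) (f : ι → Ω → ℝ) :
    avg (fun ω => ∑ i ∈ s, f i ω) = ∑ i ∈ s, avg (f i) := by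
  simp only [avg]
  rw [Finset.sum_comm, Finset.sum_div]

theorem avg_add (f g : Ω → ℝ) : avg (fun ω => f ω + g ω) = avg f + avg g := by
  simp only [avg, Finset.sum_add_distrib, add_div]

theorem avg_sub (f g : Ω → ℝ) : avg (fun ω => f ω - g ω) = avg f - avg g := by
  simp only [avg, Finset.sum_sub_distrib, sub_div]

theorem avg_const_mul (c : ℝ) (f : Ω → ℝ) : avg (fun ω => c * f ω) = c * avg f := by
  simp only [avg, ← Finset.mul_sum, mul_div_assoc]

theorem avg_const [Nonempty Ω] (c : ℝ) : avg (fun _ : Ω => c) = c := by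
  have : (Fintype.card Ω : ℝ) ≠ 0 := by simp
  simp only [avg, Finset.sum_const, Finset.card_univ, nsmul_eq_mul]
  field_simp

open Classical in
/-- The probability of an event. -/
noncomputable def prob (Q : Ω → Prop) : ℝ := avg fun ω => if Q ω then 1 else 0

theorem prob_le_avg {Q : Ω → Prop} {f : Ω → ℝ} (h0 : ∀ ω, 0 ≤ f ω) (h : ∀ ω, Q ω → 1 ≤ f ω) :
    prob Q ≤ avg f := by
  refine avg_mono fun ω => ?_
  split_ifs with hQ
  · exact h ω hQ
  · exact h0 ω

theorem prob_mono {Q R : Ω → Prop} (h : ∀ ω, Q ω → R ω) : prob Q ≤ prob R :=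
  prob_le_avg (fun ω => by split_ifs <;> norm_num) fun ω hQ => by simp [h ω hQ]

theorem prob_or_le (Q R : Ω → Prop) : prob (fun ω => Q ω ∨ R ω) ≤ prob Q + prob R := by
  rw [prob, prob, prob, ← avg_add]
  refine avg_mono fun ω => ?_
  by_cases hQ : Q ω <;> by_cases hR : R ω <;> simp [hQ, hR]

theorem prob_exists_le {ι : Type*} [Fintype ι] (Q : ι → Ω → Prop) :
    prob (fun ω => ∃ i, Q i ω) ≤ ∑ i, prob (Q i) := by
  classical
  simp only [prob]
  rw [← avg_sum]
  refine prob_le_avg (fun ω => Finset.sum_nonneg fun i _ => by split_ifs <;> norm_num) ?_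
  rintro ω ⟨i, hi⟩
  have := Finset.single_le_sum (s := Finset.univ) (f := fun i => if Q i ω then (1 : ℝ) else 0)
    (fun i _ => by split_ifs <;> norm_num) (Finset.mem_univ i)
  simpa [hi] using this

theorem markov {f : Ω → ℝ} (h0 : ∀ ω, 0 ≤ f ω) {t : ℝ} (ht : 0 < t) :
    prob (fun ω => t ≤ f ω) ≤ avg f / t := by
  rw [div_eq_inv_mul, ← avg_const_mul]
  refine prob_le_avg (fun ω => mul_nonneg (inv_nonneg.2 ht.le) (h0 ω)) fun ω h => ?_
  rw [← div_eq_inv_mul, one_le_div ht]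
  exact h

end Average

section Coins

/-- Independence of the coordinates under the uniform distribution on a product. -/
theorem avg_pi_prod {ι α : Type*} [Fintype ι] [DecidableEq ι] [Fintype α] (φ : ι → α → ℝ) :
    avg (fun ω : ι → α => ∏ i, φ i (ω i)) = ∏ i, avg (φ i) := by
  simp only [avg]
  rw [Finset.prod_div_distrib, Finset.prod_univ_sum, Fintype.piFinset_univ, Finset.prod_const,
    Finset.card_univ, Fintype.card_fun, Nat.cast_pow]

theorem avg_coins (j : ℕ) (x y : ℝ) :
    avg (fun v : Fin j → Bool => if ∀ i, v i = true then x else y) =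
      (1 / 2) ^ j * x + (1 - (1 / 2) ^ j) * y := by
  have h1 : ∀ v : Fin j → Bool, (if ∀ i, v i = true then x else y) =
      y + (x - y) * if v = fun _ => true then 1 else 0 := by
    intro v
    by_cases h : v = fun _ => true
    · simp [h]
    · rw [if_neg h, if_neg fun h' => h (funext h')]; ring
  simp only [h1]
  rw [avg_add, avg_const, avg_const_mul]
  have : avg (fun v : Fin j → Bool => if v = fun _ => true then (1 : ℝ) else 0) = (1 / 2) ^ j := by
    simp [avg]
  rw [this]
  ring

variable {m n j : ℕ}

/-- The source of all facts about the coins: `x = 1`, `y = 0` gives the probability that all of `S`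
is kept, and `y = 1` the generating function of the number of kept members. -/
theorem avg_prod_coins (S : Finset (Fin m × Fin n)) (x y : ℝ) :
    avg (fun ω : Fin m → Fin n → Fin j → Bool =>
      ∏ e ∈ S, if ∀ i, ω e.1 e.2 i = true then x else y) =
      ((1 / 2) ^ j * x + (1 - (1 / 2) ^ j) * y) ^ S.card := by
  have h1 : ∀ ω : Fin m → Fin n → Fin j → Bool,
      (∏ e ∈ S, if ∀ i, ω e.1 e.2 i = true then x else y) =
      ∏ a, ∏ b, if (a, b) ∈ S then (if ∀ i, ω a b i = true then x else y) else 1 := by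
    intro ω
    rw [← Fintype.prod_prod_type' (f := fun a b => if (a, b) ∈ S then
      (if ∀ i, ω a b i = true then x else y) else 1), Finset.prod_ite_mem, Finset.univ_inter]
  simp only [h1]
  rw [avg_pi_prod (fun a (η : Fin n → Fin j → Bool) => ∏ b, if (a, b) ∈ S then
    (if ∀ i, η b i = true then x else y) else 1)]
  have h2 : ∀ a, avg (fun η : Fin n → Fin j → Bool => ∏ b, if (a, b) ∈ S then
      (if ∀ i, η b i = true then x else y) else 1) =
      ∏ b, if (a, b) ∈ S then ((1 / 2) ^ j * x + (1 - (1 / 2) ^ j) * y) else 1 := by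
    intro a
    rw [avg_pi_prod (fun b (v : Fin j → Bool) => if (a, b) ∈ S then
      (if ∀ i, v i = true then x else y) else 1)]
    refine Finset.prod_congr rfl fun b _ => ?_
    split_ifs
    · exact avg_coins j x y
    · exact avg_const 1
  simp only [h2]
  rw [← Fintype.prod_prod_type' (f := fun a b => if (a, b) ∈ S then
      ((1 / 2) ^ j * x + (1 - (1 / 2) ^ j) * y) else 1), Finset.prod_ite_mem, Finset.univ_inter,
      Finset.prod_const]

/-- The members of `S` all of whose coins show `true`. -/
def heads (S : Finset (Fin m × Fin n)) (ω : Fin m → Fin n → Fin j → Bool) :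
    Finset (Fin m × Fin n) := S.filter fun e => ∀ i, ω e.1 e.2 i = true

theorem prob_heads_eq (S : Finset (Fin m × Fin n)) :
    prob (fun ω : Fin m → Fin n → Fin j → Bool => heads S ω = S) = ((1 / 2) ^ j) ^ S.card := by
  have := avg_prod_coins (j := j) S 1 0
  rw [mul_one, mul_zero, add_zero] at this
  rw [← this, prob]
  congr 1
  funext ω
  rw [Finset.prod_ite_zero, Finset.prod_const_one, heads, Finset.filter_eq_self]
  congr

theorem avg_pow_card_heads (S : Finset (Fin m × Fin n)) (x : ℝ) :
    avg (fun ω : Fin m → Fin n → Fin j → Bool => x ^ (heads S ω).card) =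
      (1 + (1 / 2) ^ j * (x - 1)) ^ S.card := by
  have := avg_prod_coins (j := j) S x 1
  rw [show (1 : ℝ) + (1 / 2) ^ j * (x - 1) = (1 / 2) ^ j * x + (1 - (1 / 2) ^ j) * 1 by ring,
    ← this]
  congr 1
  funext ω
  rw [Finset.prod_ite, Finset.prod_const, Finset.prod_const_one, mul_one, heads]

/-- Chernoff's method with base 2: if X members are kept, the average of 2^X is (1 + p)^|S| ≤
exp(p|S|). -/
theorem prob_card_heads_ge (S : Finset (Fin m × Fin n)) (T : ℝ) :
    prob (fun ω : Fin m → Fin n → Fin j → Bool => T ≤ (heads S ω).card) ≤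
      Real.exp ((1 / 2) ^ j * S.card) * (2 : ℝ) ^ (-T) := by
  have h1 : prob (fun ω : Fin m → Fin n → Fin j → Bool => T ≤ (heads S ω).card) ≤
      avg (fun ω : Fin m → Fin n → Fin j → Bool => (2 : ℝ) ^ (-T) * 2 ^ (heads S ω).card) := by
    refine prob_le_avg (fun ω => by positivity) fun ω h => ?_
    rw [← Real.rpow_natCast, ← Real.rpow_add (by norm_num)]
    exact Real.one_le_rpow (by norm_num) (by linarith)
  refine h1.trans ?_
  rw [avg_const_mul, avg_pow_card_heads, mul_comm]
  refine mul_le_mul_of_nonneg_right ?_ (by positivity)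
  rw [mul_comm ((1 / 2 : ℝ) ^ j) (S.card : ℝ), Real.exp_nat_mul]
  refine pow_le_pow_left₀ (by norm_num; positivity) ?_ _
  have := Real.add_one_le_exp ((1 / 2 : ℝ) ^ j)
  linarith

/-- Chernoff's method with base 1/2: the average of 2^(-X) is (1 - p/2)^|S| ≤ exp(-μ/2), and the
threshold costs the factor 2^(μ/4) ≤ exp(μ/4). -/
theorem prob_card_heads_le (S : Finset (Fin m × Fin n)) :
    prob (fun ω : Fin m → Fin n → Fin j → Bool =>
      ((heads S ω).card : ℝ) ≤ (1 / 2) ^ j * S.card / 4) ≤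
      Real.exp (-((1 / 2) ^ j * S.card / 4)) := by
  set μ : ℝ := (1 / 2) ^ j * S.card with hμ
  have hμ0 : 0 ≤ μ := by positivity
  have h1 : prob (fun ω : Fin m → Fin n → Fin j → Bool => ((heads S ω).card : ℝ) ≤ μ / 4) ≤
      avg (fun ω : Fin m → Fin n → Fin j → Bool =>
        (2 : ℝ) ^ (μ / 4) * (1 / 2) ^ (heads S ω).card) := by
    refine prob_le_avg (fun ω => by positivity) fun ω h => ?_
    rw [one_div, inv_pow, ← Real.rpow_natCast, ← Real.rpow_neg (by norm_num),
      ← Real.rpow_add (by norm_num)]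
    exact Real.one_le_rpow (by norm_num) (by linarith)
  refine h1.trans ?_
  rw [avg_const_mul, avg_pow_card_heads]
  have h2 : (2 : ℝ) ^ (μ / 4) ≤ Real.exp (μ / 4) := by
    rw [Real.rpow_def_of_pos (by norm_num)]
    refine Real.exp_le_exp.2 ?_
    have := Real.log_two_lt_d9
    nlinarith
  have h5 : (0 : ℝ) ≤ 1 + (1 / 2 : ℝ) ^ j * (1 / 2 - 1) := by
    have : (1 / 2 : ℝ) ^ j ≤ 1 := pow_le_one₀ (by norm_num) (by norm_num)
    linarith
  have h3 : (1 + (1 / 2 : ℝ) ^ j * (1 / 2 - 1)) ^ S.card ≤ Real.exp (-(μ / 2)) := by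
    have h4 : (1 + (1 / 2 : ℝ) ^ j * (1 / 2 - 1)) ≤ Real.exp (-((1 / 2) ^ j / 2)) := by
      have := Real.add_one_le_exp (-((1 / 2 : ℝ) ^ j / 2))
      linarith
    calc _ ≤ Real.exp (-((1 / 2) ^ j / 2)) ^ S.card := pow_le_pow_left₀ h5 h4 _
      _ = _ := by rw [← Real.exp_nat_mul]; congr 1; rw [hμ]; ring
  calc _ ≤ Real.exp (μ / 4) * Real.exp (-(μ / 2)) :=
        mul_le_mul h2 h3 (pow_nonneg h5 _) (Real.exp_pos _).le
    _ = _ := by rw [← Real.exp_add]; congr 1; ring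

end Coins

/-! ### The expected number of edges on short cycles -/

namespace SimpleGraph

variable {V : Type*} [Fintype V] [DecidableEq V] (G : SimpleGraph V) [DecidableRel G.Adj]

/-- Both ends are fixed, so the last step is forced and only `l` of the `l + 1` steps are free. The
factor `d` saved here is essential for the count of short cycles. -/
theorem card_finsetWalkLength_succ_le {d : ℕ} (hd : ∀ v, G.degree v ≤ d) (l : ℕ) (u v : V) :
    (G.finsetWalkLength (l + 1) u v).card ≤ d ^ l := by
  induction l generalizing u with
  | zero =>
    rw [pow_zero, Finset.card_le_one]
    intro w hw w' hw'
    rw [mem_finsetWalkLength_iff] at hw hw'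
    cases w with
    | nil => simp at hw
    | cons h w =>
      cases w' with
      | nil => simp at hw'
      | cons h' w' =>
        cases w with
        | nil =>
          cases w' with
          | nil => rfl
          | cons _ _ => simp at hw'
        | cons _ _ => simp at hw
  | succ l ih =>
    rw [finsetWalkLength]
    refine Finset.card_biUnion_le.trans ?_
    calc _ ≤ ∑ _w : G.neighborSet u, d ^ l := by
          refine Finset.sum_le_sum fun w _ => ?_
          rw [Finset.card_map]
          exact ih _
      _ = G.degree u * d ^ l := by
          rw [Finset.sum_const, Finset.card_univ, card_neighborSet_eq_degree, smul_eq_mul]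
      _ ≤ d * d ^ l := Nat.mul_le_mul_right _ (hd u)
      _ = d ^ (l + 1) := by ring

end SimpleGraph

section Cycles

variable {m n j d : ℕ} {E : Finset (Fin m × Fin n)}

open Classical in
theorem degree_bipGraph_le (hA : ∀ a, (E.filter fun e => e.1 = a).card ≤ d)
    (hB : ∀ b, (E.filter fun e => e.2 = b).card ≤ d) (v : Fin m ⊕ Fin n) :
    (bipGraph E).degree v ≤ d := by
  rcases v with a | b
  · refine le_trans ?_ (hA a)
    rw [← SimpleGraph.card_neighborFinset_eq_degree]
    refine (Finset.card_le_card (t := (E.filter fun e => e.1 = a).image fun e => Sum.inr e.2)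
      fun v hv => ?_).trans Finset.card_image_le
    rw [SimpleGraph.mem_neighborFinset] at hv
    rcases v with a' | b
    · simp at hv
    · simpa using hv
  · refine le_trans ?_ (hB b)
    rw [← SimpleGraph.card_neighborFinset_eq_degree]
    refine (Finset.card_le_card (t := (E.filter fun e => e.2 = b).image fun e => Sum.inl e.1)
      fun v hv => ?_).trans Finset.card_image_le
    rw [SimpleGraph.mem_neighborFinset] at hv
    rcases v with a | b'
    · simpa using hv
    · simp at hv

open Classical in
/-- The edges of a walk. -/
noncomputable def walkEdges {u v : Fin m ⊕ Fin n} (w : (bipGraph E).Walk u v) :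
    Finset (Fin m × Fin n) := E.filter fun f => s(.inl f.1, .inr f.2) ∈ w.edges

theorem length_le_card_walkEdges {u v : Fin m ⊕ Fin n} {w : (bipGraph E).Walk u v}
    (hw : w.edges.Nodup) : w.length ≤ (walkEdges w).card := by
  classical
  have h1 : w.edges.toFinset ⊆ (walkEdges w).image fun f => s(.inl f.1, .inr f.2) := by
    intro z hz
    rw [List.mem_toFinset] at hz
    obtain ⟨f, hf, rfl⟩ := mem_edgeSet_bipGraph.1 (w.edges_subset_edgeSet hz)
    exact Finset.mem_image.2 ⟨f, by simp only [walkEdges, Finset.mem_filter]; exact ⟨hf, hz⟩, rfl⟩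
  have h2 := (Finset.card_le_card h1).trans Finset.card_image_le
  rwa [List.toFinset_card_of_nodup hw, SimpleGraph.Walk.length_edges] at h2

open Classical in
/-- The trails of length `l` that join the ends of `e` and avoid `e`. -/
noncomputable def detours (E : Finset (Fin m × Fin n)) (e : Fin m × Fin n) (l : ℕ) :
    Finset ((bipGraph E).Walk (.inl e.1) (.inr e.2)) :=
  ((bipGraph E).finsetWalkLength l (.inl e.1) (.inr e.2)).filter fun w =>
    w.edges.Nodup ∧ s(.inl e.1, .inr e.2) ∉ w.edges

/-- Passing to a path makes the edges distinct, so that each of them costs a factor p. The path is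
moved to the graph of `E` because the union bound has to run over walks that do not depend on `ω`.
-/
theorem exists_detour {ω : Fin m → Fin n → Fin j → Bool} {e : Fin m × Fin n} {t : ℕ}
    (he : e ∈ heads E ω) (h : joined (heads E ω) t e = true) :
    ∃ l < t, ∃ w ∈ detours E e (l + 1),
      heads (insert e (walkEdges w)) ω = insert e (walkEdges w) := by
  classical
  obtain ⟨w, hw⟩ := joined_iff.1 h
  set w' := w.bypass with hw'
  have hlen : w'.length ≤ t := (w.length_bypass_le_length).trans hw
  have hedge : ∀ z ∈ w'.edges, ∃ f ∈ (heads E ω).erase e, z = s(.inl f.1, .inr f.2) :=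
    fun z hz => mem_edgeSet_bipGraph.1 (w'.edges_subset_edgeSet hz)
  have hE : ∀ z ∈ w'.edges, z ∈ (bipGraph E).edgeSet := fun z hz => by
    obtain ⟨f, hf, rfl⟩ := hedge z hz
    exact mem_edgeSet_bipGraph.2 ⟨f, (Finset.mem_filter.1 (Finset.mem_of_mem_erase hf)).1, rfl⟩
  have hpos : w'.length ≠ 0 := fun h0 => by
    have := SimpleGraph.Walk.eq_of_length_eq_zero h0
    simp at this
  obtain ⟨l, hl⟩ := Nat.exists_eq_succ_of_ne_zero hpos
  refine ⟨l, by omega, w'.transfer _ hE, ?_, ?_⟩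
  · simp only [detours, Finset.mem_filter, SimpleGraph.mem_finsetWalkLength_iff,
      SimpleGraph.Walk.length_transfer, SimpleGraph.Walk.edges_transfer]
    refine ⟨hl, (w.bypass_isPath).isTrail.edges_nodup, fun hmem => ?_⟩
    obtain ⟨f, hf, hfe⟩ := hedge _ hmem
    have : f = e := by
      simp only [Sym2.eq_iff, Sum.inl.injEq, Sum.inr.injEq, reduceCtorEq, and_self, or_false] at hfe
      exact Prod.ext hfe.1.symm hfe.2.symm
    exact Finset.ne_of_mem_erase hf this
  · rw [heads, Finset.filter_eq_self]
    intro f hf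
    rw [Finset.mem_insert] at hf
    rcases hf with rfl | hf
    · exact (Finset.mem_filter.1 he).2
    · simp only [walkEdges, Finset.mem_filter, SimpleGraph.Walk.edges_transfer] at hf
      obtain ⟨g, hg, hge⟩ := hedge _ hf.2
      have : f = g := by
        simp only [Sym2.eq_iff, Sum.inl.injEq, Sum.inr.injEq, reduceCtorEq, and_self, or_false]
          at hge
        exact Prod.ext hge.1 hge.2
      rw [this]
      exact (Finset.mem_filter.1 (Finset.mem_of_mem_erase hg)).2

theorem avg_card_joined_le (hA : ∀ a, (E.filter fun e => e.1 = a).card ≤ d)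
    (hB : ∀ b, (E.filter fun e => e.2 = b).card ≤ d) (t : ℕ) :
    avg (fun ω : Fin m → Fin n → Fin j → Bool =>
      (((heads E ω).filter fun e => joined (heads E ω) t e = true).card : ℝ)) ≤
      E.card * ∑ l ∈ Finset.range t, (d : ℝ) ^ l * ((1 / 2) ^ j) ^ (l + 2) := by
  classical
  have hp : ∀ (s r : ℕ), s ≤ r → ((1 / 2 : ℝ) ^ j) ^ r ≤ ((1 / 2) ^ j) ^ s := fun s r h =>
    pow_le_pow_of_le_one (by positivity) (pow_le_one₀ (by norm_num) (by norm_num)) h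
  calc _ ≤ avg (fun ω : Fin m → Fin n → Fin j → Bool => ∑ e ∈ E, ∑ l ∈ Finset.range t,
        ∑ w ∈ detours E e (l + 1),
          if heads (insert e (walkEdges w)) ω = insert e (walkEdges w) then (1 : ℝ) else 0) := by
        refine avg_mono fun ω => ?_
        rw [heads, Finset.filter_filter, Finset.card_filter, Nat.cast_sum]
        refine Finset.sum_le_sum fun e he => ?_
        rw [Nat.cast_ite, Nat.cast_one, Nat.cast_zero]
        have h0 : ∀ l ∈ Finset.range t, 0 ≤ ∑ w ∈ detours E e (l + 1),
          if heads (insert e (walkEdges w)) ω = insert e (walkEdges w) then (1 : ℝ) else 0 :=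
          fun l _ => Finset.sum_nonneg fun w _ => by positivity
        split_ifs with h
        · obtain ⟨l, hl, w, hw, hins⟩ := exists_detour (Finset.mem_filter.2 ⟨he, h.1⟩) h.2
          refine le_trans ?_ (Finset.single_le_sum h0 (Finset.mem_range.2 hl))
          refine le_trans ?_ (Finset.single_le_sum (fun w _ => by positivity) hw)
          rw [if_pos hins]
        · exact Finset.sum_nonneg h0
    _ = ∑ e ∈ E, ∑ l ∈ Finset.range t, ∑ w ∈ detours E e (l + 1),
        ((1 / 2 : ℝ) ^ j) ^ (insert e (walkEdges w)).card := by
        rw [avg_sum]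
        refine Finset.sum_congr rfl fun e _ => ?_
        rw [avg_sum]
        refine Finset.sum_congr rfl fun l _ => ?_
        rw [avg_sum]
        refine Finset.sum_congr rfl fun w _ => ?_
        rw [← prob_heads_eq, prob]
        congr 1
        funext ω
        congr
    _ ≤ ∑ e ∈ E, ∑ l ∈ Finset.range t, (d : ℝ) ^ l * ((1 / 2) ^ j) ^ (l + 2) := by
        refine Finset.sum_le_sum fun e _ => Finset.sum_le_sum fun l _ => ?_
        calc _ ≤ ∑ w ∈ detours E e (l + 1), ((1 / 2 : ℝ) ^ j) ^ (l + 2) := by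
              refine Finset.sum_le_sum fun w hw => hp _ _ ?_
              simp only [detours, Finset.mem_filter, SimpleGraph.mem_finsetWalkLength_iff] at hw
              have h1 := length_le_card_walkEdges hw.2.1
              -- A detour has `l + 1` distinct edges, none of which is `e`: together `l + 2`
              -- independent events.
              rw [Finset.card_insert_of_notMem (by simp [walkEdges, hw.2.2])]
              omega
          _ = (detours E e (l + 1)).card * ((1 / 2 : ℝ) ^ j) ^ (l + 2) := by
              rw [Finset.sum_const, nsmul_eq_mul]
          _ ≤ _ := by
              gcongr
              exact_mod_cast (Finset.card_filter_le _ _).trans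
                ((bipGraph E).card_finsetWalkLength_succ_le (degree_bipGraph_le hA hB) l _ _)
    _ = _ := by rw [Finset.sum_const, nsmul_eq_mul]

end Cycles

/-! ### The parameters of the reduction -/

section Parameters

variable {d k : ℕ}

/-- With L = ⌊log d⌋ and 2^L ≤ d < 2^(L+1), this places D = p d between 2^(⌊L/k⌋ - 1) and 2^⌊L/k⌋.
-/
theorem half_pow_coinCount (hd : 1 ≤ d) (hk : 1 ≤ k) :
    (1 / 2 : ℝ) ^ coinCount d k * 2 ^ (Nat.log 2 d + 1) = 2 ^ (Nat.log 2 d / k) := by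
  have h1 : Nat.log 2 d / k ≤ Nat.log 2 d := Nat.div_le_self _ _
  have h2 : Nat.log 2 d + 1 = coinCount d k + Nat.log 2 d / k := by
    rw [coinCount_eq hd hk]; omega
  rw [h2, pow_add, ← mul_assoc, ← mul_pow]
  norm_num

theorem pow_density_le (hd : 1 ≤ d) (hk : 1 ≤ k) :
    ((1 / 2 : ℝ) ^ coinCount d k * d) ^ k ≤ d := by
  have h1 : (d : ℝ) ≤ 2 ^ (Nat.log 2 d + 1) := by
    exact_mod_cast (Nat.lt_pow_succ_log_self (by norm_num) d).le
  have h2 : (2 : ℝ) ^ Nat.log 2 d ≤ d := by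
    exact_mod_cast Nat.pow_log_le_self 2 (by omega)
  calc _ ≤ ((1 / 2 : ℝ) ^ coinCount d k * 2 ^ (Nat.log 2 d + 1)) ^ k := by gcongr
    _ = 2 ^ (Nat.log 2 d / k * k) := by rw [half_pow_coinCount hd hk, ← pow_mul]
    _ ≤ 2 ^ Nat.log 2 d := pow_le_pow_right₀ (by norm_num) (Nat.div_mul_le_self _ _)
    _ ≤ d := h2

/-- One factor 2 pays for rounding L/k down, the other for p 2^L being only half of p 2^(L+1). -/
theorem rpow_le_four_mul_density (hd : 1 ≤ d) (hk : 1 ≤ k) :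
    (d : ℝ) ^ (1 / (k : ℝ)) ≤ 4 * ((1 / 2 : ℝ) ^ coinCount d k * d) := by
  have h1 : (d : ℝ) ≤ 2 ^ (Nat.log 2 d + 1) := by
    exact_mod_cast (Nat.lt_pow_succ_log_self (by norm_num) d).le
  have h2 : (2 : ℝ) ^ Nat.log 2 d ≤ d := by
    exact_mod_cast Nat.pow_log_le_self 2 (by omega)
  have h3 : Nat.log 2 d + 1 ≤ (Nat.log 2 d / k + 1) * k := by
    have := Nat.lt_div_mul_add (a := Nat.log 2 d) (b := k) (by omega)
    rw [add_mul]; omega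
  have h4 : (2 : ℝ) ^ (Nat.log 2 d / k + 1) ≤ 4 * ((1 / 2 : ℝ) ^ coinCount d k * d) := by
    calc (2 : ℝ) ^ (Nat.log 2 d / k + 1)
        = 4 * ((1 / 2 : ℝ) ^ coinCount d k * 2 ^ Nat.log 2 d) := by
          have := half_pow_coinCount hd hk
          rw [pow_succ] at this ⊢
          rw [← this]; ring
      _ ≤ _ := by gcongr
  refine le_trans ?_ h4
  have h5 : (d : ℝ) ≤ ((2 : ℝ) ^ (Nat.log 2 d / k + 1)) ^ k := by
    rw [← pow_mul]
    exact h1.trans (pow_le_pow_right₀ (by norm_num) h3)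
  calc (d : ℝ) ^ (1 / (k : ℝ)) ≤ (((2 : ℝ) ^ (Nat.log 2 d / k + 1)) ^ k) ^ (1 / (k : ℝ)) := by
        gcongr
    _ = _ := by rw [one_div, Real.pow_rpow_inv_natCast (by positivity) (by omega)]

theorem mul_geom_sum_le {D : ℝ} (hD : 2 ≤ D) (t : ℕ) :
    D * ∑ l ∈ Finset.range t, D ^ l ≤ 2 * D ^ t := by
  induction t with
  | zero => simp
  | succ t ih =>
    have : 0 ≤ D ^ t := by positivity
    rw [Finset.sum_range_succ, mul_add, pow_succ]
    nlinarith

end Parameters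

theorem Real.exp_neg_le_one_div {x : ℝ} (hx : 0 < x) : Real.exp (-x) ≤ 1 / x := by
  rw [Real.exp_neg, ← one_div]
  exact one_div_le_one_div_of_le hx (by have := Real.add_one_le_exp x; linarith)

/-! ### Survival of many edges -/

section HighGirth

variable {m n j d k : ℕ} {E : Finset (Fin m × Fin n)}

theorem mem_highGirth {F : Finset (Fin m × Fin n)} {e : Fin m × Fin n} :
    e ∈ highGirth F k ↔ e ∈ F ∧ joined F (k - 1) e = false := Finset.mem_filter

/-- With high probability, many edges remain. -/
theorem prob_card_highGirth_le (hk : 1 ≤ k) (hE : d ≤ E.card)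
    (hA : ∀ a, (E.filter fun e => e.1 = a).card ≤ d)
    (hB : ∀ b, (E.filter fun e => e.2 = b).card ≤ d)
    (hD : 2 ≤ (1 / 2 : ℝ) ^ j * d) (hDk : ((1 / 2 : ℝ) ^ j * d) ^ k ≤ d) :
    prob (fun ω : Fin m → Fin n → Fin j → Bool =>
      ((highGirth (heads E ω) k).card : ℝ) ≤ (1 / 2) ^ j * E.card / 8) ≤
      20 / ((1 / 2) ^ j * d) := by
  set p : ℝ := (1 / 2) ^ j with hp
  have hp0 : 0 < p := by positivity
  set D : ℝ := p * d with hDdef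
  have hD0 : 0 < D := by linarith
  have hDE : D ≤ p * E.card := by rw [hDdef]; gcongr
  have hμ : 0 < p * E.card := hD0.trans_le hDE
  have h1 : prob (fun ω : Fin m → Fin n → Fin j → Bool =>
      ((heads E ω).card : ℝ) ≤ p * E.card / 4) ≤ 4 / D := by
    refine (prob_card_heads_le E).trans ?_
    rw [← hp]
    calc _ ≤ 1 / (p * E.card / 4) := Real.exp_neg_le_one_div (by positivity)
      _ = 4 / (p * E.card) := by rw [one_div_div]
      _ ≤ 4 / D := by gcongr
  -- The sum is p² ∑ D^l, a geometric sum of at most 2 D^(k-1) / D, and D^k ≤ d gives D^(k-1) ≤ d /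
  -- D = 1 / p.
  have hsum : ∑ l ∈ Finset.range (k - 1), (d : ℝ) ^ l * p ^ (l + 2) ≤ 2 * p / D := by
    have e1 : ∑ l ∈ Finset.range (k - 1), (d : ℝ) ^ l * p ^ (l + 2) =
        p ^ 2 * ∑ l ∈ Finset.range (k - 1), D ^ l := by
      rw [Finset.mul_sum]
      refine Finset.sum_congr rfl fun l _ => ?_
      rw [hDdef, mul_pow]; ring
    have e2 := mul_geom_sum_le hD (k - 1)
    have e3 : D ^ (k - 1) * D ≤ d := by rw [← pow_succ, Nat.sub_add_cancel hk]; exact hDk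
    rw [e1, le_div_iff₀ hD0]
    have e4 : D * (D * ∑ l ∈ Finset.range (k - 1), D ^ l) ≤ 2 * d := by
      calc _ ≤ D * (2 * D ^ (k - 1)) := by gcongr
        _ = 2 * (D ^ (k - 1) * D) := by ring
        _ ≤ 2 * d := by gcongr
    have e5 : p * (D * ∑ l ∈ Finset.range (k - 1), D ^ l) ≤ 2 := by
      refine le_of_mul_le_mul_left ?_ hD0
      calc _ = p * (D * (D * ∑ l ∈ Finset.range (k - 1), D ^ l)) := by ring
        _ ≤ p * (2 * d) := by gcongr
        _ = D * 2 := by rw [hDdef]; ring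
    calc _ = p * (p * (D * ∑ l ∈ Finset.range (k - 1), D ^ l)) := by ring
      _ ≤ p * 2 := by gcongr
      _ = 2 * p := by ring
  have h2 : prob (fun ω : Fin m → Fin n → Fin j → Bool => p * E.card / 8 ≤
      (((heads E ω).filter fun e => joined (heads E ω) (k - 1) e = true).card : ℝ)) ≤ 16 / D := by
    refine (markov (fun ω => Nat.cast_nonneg _) (by positivity)).trans ?_
    rw [div_le_iff₀ (by positivity)]
    refine (avg_card_joined_le hA hB (k - 1)).trans ?_
    calc _ ≤ E.card * (2 * p / D) := by gcongr
      _ = _ := by ring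
  calc _ ≤ prob (fun ω : Fin m → Fin n → Fin j → Bool =>
        ((heads E ω).card : ℝ) ≤ p * E.card / 4 ∨ p * E.card / 8 ≤
        (((heads E ω).filter fun e => joined (heads E ω) (k - 1) e = true).card : ℝ)) := by
        -- Otherwise more than p|E|/4 edges are kept and fewer than p|E|/8 of these are deleted.
        refine prob_mono fun ω h => ?_
        by_contra! hcon
        have e1 := Finset.card_filter_add_card_filter_not (s := heads E ω)
          (fun e => joined (heads E ω) (k - 1) e = true)
        have e2 : ((heads E ω).filter fun e => ¬ joined (heads E ω) (k - 1) e = true) =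
            highGirth (heads E ω) k := by
          rw [highGirth]
          exact Finset.filter_congr fun e _ => by simp
        rw [e2] at e1
        have e3 : (((heads E ω).filter fun e => joined (heads E ω) (k - 1) e = true).card : ℝ) +
          (highGirth (heads E ω) k).card = (heads E ω).card := by exact_mod_cast e1
        linarith [hcon.1, hcon.2]
    _ ≤ 4 / D + 16 / D := (prob_or_le _ _).trans (add_le_add h1 h2)
    _ = 20 / D := by ring

end HighGirth

/-! ### Completeness and soundness of the sparsification -/

namespace LabelCover

theorem mem_satisfied {I : LabelCover} {γA : Fin I.nA → Fin I.qA} {γB : Fin I.nB → Fin I.qB}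
    {e : Fin I.nA × Fin I.nB} :
    e ∈ I.satisfied γA γB ↔ e ∈ I.E ∧ (γA e.1, γB e.2) ∈ I.rel e := Finset.mem_filter

variable (I : LabelCover)

theorem card_satisfied_sparsify_le {j : ℕ} (ω : Fin I.nA → Fin I.nB → Fin j → Bool) (k : ℕ)
    (γA : Fin I.nA → Fin I.qA) (γB : Fin I.nB → Fin I.qB) :
    ((I.sparsify ω k).satisfied γA γB).card ≤ (heads (I.satisfied γA γB) ω).card := by
  refine Finset.card_le_card fun e he => ?_
  obtain ⟨h1, h2⟩ := (mem_satisfied (I := I.sparsify ω k)).1 he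
  obtain ⟨h3, h4⟩ := Finset.mem_filter.1 ((mem_highGirth (F := I.kept ω)).1 h1).1
  exact Finset.mem_filter.2 ⟨mem_satisfied.2 ⟨h3, h2⟩, h4⟩

variable {I}

theorem FullySatisfiable.sparsify (h : I.FullySatisfiable) {j : ℕ}
    (ω : Fin I.nA → Fin I.nB → Fin j → Bool) (k : ℕ) : (I.sparsify ω k).FullySatisfiable := by
  obtain ⟨γA, γB, h⟩ := h
  refine ⟨γA, γB, Finset.ext fun e => (mem_satisfied (I := I.sparsify ω k)).trans
    ⟨fun he => he.1, fun he => ⟨he, ?_⟩⟩⟩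
  have h1 : e ∈ I.satisfied γA γB := by rw [h]; exact I.highGirth_kept_subset ω k he
  exact (mem_satisfied.1 h1).2

theorem Regular.card_eq {d : ℕ} (h : I.Regular d) : I.E.card = I.nA * d := by
  rw [Finset.card_eq_sum_card_fiberwise (f := Prod.fst) (t := Finset.univ) (by simp)]
  simp [h.1]

/-- With high probability, few of the edges that remain can be satisfied. -/
theorem prob_exists_satisfied_le {j : ℕ} {s α : ℝ} (hq : 2 ≤ I.qA)
    (hqB : I.qB ≤ I.qA) (hα : 0 < α) (hs : s ≤ 1 / α) (h : I.ValueAtMost s)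
    (hlog : I.numVertices * Real.logb 2 I.qA ≤ 8 * ((1 / 2) ^ j * I.E.card / α)) :
    prob (fun ω : Fin I.nA → Fin I.nB → Fin j → Bool =>
      ∃ γ : (Fin I.nA → Fin I.qA) × (Fin I.nB → Fin I.qB),
        18 * ((1 / 2) ^ j * I.E.card / α) ≤ ((heads (I.satisfied γ.1 γ.2) ω).card : ℝ)) ≤
      (2 : ℝ) ^ (-(I.numVertices : ℝ)) := by
  set θ : ℝ := (1 / 2) ^ j * I.E.card / α with hθ
  have hθ0 : 0 ≤ θ := by positivity
  have hq0 : (0 : ℝ) < I.qA := by exact_mod_cast (by omega : 0 < I.qA)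
  have hlogq : 1 ≤ Real.logb 2 I.qA := by
    rw [Real.le_logb_iff_rpow_le (by norm_num) hq0, Real.rpow_one]
    exact_mod_cast hq
  have h1 : ∀ γ : (Fin I.nA → Fin I.qA) × (Fin I.nB → Fin I.qB),
      prob (fun ω : Fin I.nA → Fin I.nB → Fin j → Bool =>
        18 * θ ≤ ((heads (I.satisfied γ.1 γ.2) ω).card : ℝ)) ≤ (2 : ℝ) ^ (-(16 * θ)) := by
    intro γ
    refine (prob_card_heads_ge _ _).trans ?_
    have e1 : (1 / 2 : ℝ) ^ j * (I.satisfied γ.1 γ.2).card ≤ θ := by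
      calc (1 / 2 : ℝ) ^ j * (I.satisfied γ.1 γ.2).card
          ≤ (1 / 2) ^ j * (1 / α * I.E.card) := by
            gcongr
            exact (h γ.1 γ.2).trans (by gcongr)
        _ = θ := by rw [hθ]; ring
    -- Here e ≤ 2^2 is used, that is, log 2 > 1/2 for the natural logarithm.
    have e2 : Real.exp ((1 / 2 : ℝ) ^ j * (I.satisfied γ.1 γ.2).card) ≤ (2 : ℝ) ^ (2 * θ) := by
      rw [Real.rpow_def_of_pos (by norm_num)]
      refine Real.exp_le_exp.2 (e1.trans ?_)
      have := Real.log_two_gt_d9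
      nlinarith
    calc _ ≤ (2 : ℝ) ^ (2 * θ) * 2 ^ (-(18 * θ)) := by gcongr
      _ = _ := by rw [← Real.rpow_add (by norm_num)]; congr 1; ring
  -- At most σ_A^n pairs of assignments, as σ_B ≤ σ_A; half of the exponent 16θ is left after the
  -- union bound.
  have h2 : (Fintype.card ((Fin I.nA → Fin I.qA) × (Fin I.nB → Fin I.qB)) : ℝ) ≤
      (2 : ℝ) ^ (8 * θ) := by
    rw [Fintype.card_prod, Fintype.card_fun, Fintype.card_fun, Fintype.card_fin, Fintype.card_fin,
      Fintype.card_fin, Fintype.card_fin]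
    calc ((I.qA ^ I.nA * I.qB ^ I.nB : ℕ) : ℝ) ≤ ((I.qA ^ I.nA * I.qA ^ I.nB : ℕ) : ℝ) := by
          gcongr
      _ = (I.qA : ℝ) ^ (I.numVertices : ℝ) := by
          rw [← pow_add, Real.rpow_natCast, numVertices]; norm_cast
      _ = ((2 : ℝ) ^ Real.logb 2 I.qA) ^ (I.numVertices : ℝ) := by
          rw [Real.rpow_logb (by norm_num) (by norm_num) hq0]
      _ = (2 : ℝ) ^ (I.numVertices * Real.logb 2 I.qA) := by
          rw [← Real.rpow_mul (by norm_num), mul_comm]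
      _ ≤ (2 : ℝ) ^ (8 * θ) := Real.rpow_le_rpow_of_exponent_le (by norm_num) hlog
  calc _ ≤ ∑ _γ : (Fin I.nA → Fin I.qA) × (Fin I.nB → Fin I.qB), (2 : ℝ) ^ (-(16 * θ)) :=
        (prob_exists_le _).trans (Finset.sum_le_sum fun γ _ => h1 γ)
    _ = Fintype.card ((Fin I.nA → Fin I.qA) × (Fin I.nB → Fin I.qB)) * (2 : ℝ) ^ (-(16 * θ)) := by
        rw [Finset.sum_const, nsmul_eq_mul, Finset.card_univ]
    _ ≤ (2 : ℝ) ^ (8 * θ) * 2 ^ (-(16 * θ)) := by gcongr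
    _ = (2 : ℝ) ^ (-(8 * θ)) := by rw [← Real.rpow_add (by norm_num)]; congr 1; ring
    _ ≤ _ := by
        -- 8θ ≥ n log σ_A ≥ n because σ_A ≥ 2.
        refine Real.rpow_le_rpow_of_exponent_le (by norm_num) (neg_le_neg ?_)
        refine le_trans ?_ hlog
        nlinarith [(Nat.cast_nonneg I.numVertices : (0 : ℝ) ≤ I.numVertices)]

end LabelCover

/-! ### The main theorem -/

theorem tendsto_failure_probability :
    Tendsto (fun n : ℕ => 5 / Real.logb 2 n + (2 : ℝ) ^ (-(n : ℝ))) atTop (nhds 0) := by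
  have h1 : Tendsto (fun n : ℕ => 5 / Real.logb 2 n) atTop (nhds 0) :=
    (tendsto_const_nhds (x := (5 : ℝ))).div_atTop
      ((Real.tendsto_logb_atTop (by norm_num)).comp tendsto_natCast_atTop_atTop)
  have h2 : Tendsto (fun n : ℕ => (2 : ℝ) ^ (-(n : ℝ))) atTop (nhds 0) := by
    have := tendsto_pow_atTop_nhds_zero_of_lt_one (r := (1 / 2 : ℝ)) (by norm_num) (by norm_num)
    refine this.congr fun n => ?_
    rw [Real.rpow_neg (by norm_num), Real.rpow_natCast, one_div, inv_pow]
  simpa using h1.add h2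

theorem mainTheorem5 :
    ∃ c : ℝ, 0 < c ∧
      ∀ (d σA σB k : ℕ → ℕ) (s α : ℕ → ℝ),
        PolyTimeComputable k →
        (∀ᶠ n in atTop, 2 ≤ σA n ∧ σB n ≤ σA n) →
        (∀ᶠ n in atTop, 0 < s n) →
        ¬ RandPolyTimeDistinguishable
            (fun I => I.Balanced σA σB ∧ I.Regular (d I.numVertices) ∧ I.FullySatisfiable)
            (fun I => I.Balanced σA σB ∧ I.Regular (d I.numVertices) ∧
              I.ValueAtMost (s I.numVertices)) →
        (∀ᶠ n : ℕ in atTop,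
          18 * Real.logb 2 (n : ℝ) ≤ α n ∧
          α n ≤ min (1 / s n) ((d n : ℝ) ^ (1 / (k n : ℝ)) / Real.logb 2 (σA n : ℝ))) →
        ¬ RandPolyTimeDistinguishable
            (fun I => I.Balanced σA σB ∧ I.E.Nonempty ∧
              (k I.numVertices : ℕ∞) < I.supergraph.egirth ∧ I.FullySatisfiable)
            (fun I => I.Balanced σA σB ∧ I.E.Nonempty ∧
              (k I.numVertices : ℕ∞) < I.supergraph.egirth ∧
              I.ValueAtMost (c / α I.numVertices)) := by
  -- 144 = 18 · 8: fewer than 18 p|E|/α satisfied edges among more than p|E|/8 remaining ones.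
  refine ⟨144, by norm_num, ?_⟩
  rintro d σA σB k s α hk hσ hs hhard hα ⟨P, p, ε₀, N₀, hε₀, hhalt, hP⟩
  refine hhard ?_
  obtain ⟨P', p', hP'⟩ := LabelCover.exists_reduction hk P p hhalt
  -- On bad coins only 0 ≤ Pr ≤ 1 is known; ε ≤ 1/2 makes this imply the bounds 1/2 + ε - 1 ≤ Pr ≤
  -- 1/2 - ε + 1.
  set ε := min ε₀ (1 / 2) with hε
  have hε0 : 0 < ε := lt_min hε₀ (by norm_num)
  have hεle : ε ≤ ε₀ := min_le_left _ _
  have hεhalf : ε ≤ 1 / 2 := min_le_right _ _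
  have hev : ∀ᶠ n : ℕ in atTop, 5 / Real.logb 2 n + (2 : ℝ) ^ (-(n : ℝ)) ≤ ε / 2 :=
    (tendsto_failure_probability.eventually (gt_mem_nhds (half_pos hε0))).mono fun n h => h.le
  obtain ⟨N, hN⟩ := (hσ.and (hs.and (hα.and (hev.and
    ((eventually_ge_atTop N₀).and (eventually_ge_atTop 2)))))).exists_forall_of_atTop
  refine ⟨P', p', ε / 2, N, half_pos hε0, fun I => (hP' I).1, fun I hI => ?_⟩
  obtain ⟨⟨hσ2, hσB⟩, hs0, ⟨hα1, hα2⟩, hδ, hN₀, hn2⟩ := hN _ hI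
  set n := I.numVertices with hn
  rw [le_min_iff] at hα2
  have hlogn : 1 ≤ Real.logb 2 n := by
    rw [Real.le_logb_iff_rpow_le (by norm_num) (by positivity), Real.rpow_one]
    exact_mod_cast hn2
  have hlogσ : 1 ≤ Real.logb 2 (σA n) := by
    rw [Real.le_logb_iff_rpow_le (by norm_num) (by positivity), Real.rpow_one]
    exact_mod_cast hσ2
  have hα0 : 0 < α n := by linarith
  have hA : α n * Real.logb 2 (σA n) ≤ (d n : ℝ) ^ (1 / (k n : ℝ)) :=
    (le_div_iff₀ (by linarith)).1 hα2.2
  have hA18 : 18 * Real.logb 2 n ≤ (d n : ℝ) ^ (1 / (k n : ℝ)) := by nlinarith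
  -- For k = 0 the exponent 1 / 0 is 0 and the power is 1, less than 18 log n.
  have hk1 : 1 ≤ k n := by
    by_contra! h
    have : k n = 0 := by omega
    rw [this] at hA18
    norm_num at hA18
    linarith
  have hd1 : 1 ≤ d n := by
    by_contra! h
    have : d n = 0 := by omega
    rw [this, Nat.cast_zero, Real.zero_rpow (by positivity)] at hA18
    linarith
  suffices main : I.Balanced σA σB → I.Regular (d n) →
      (I.FullySatisfiable → 1 / 2 + ε / 2 ≤ P'.acceptProb I.encode (p'.eval I.encode.size)) ∧
      (I.ValueAtMost (s n) → P'.acceptProb I.encode (p'.eval I.encode.size) ≤ 1 / 2 - ε / 2) from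
    ⟨fun h => (main h.1 h.2.1).1 h.2.2, fun h => (main h.1 h.2.1).2 h.2.2⟩
  intro hbal hreg
  have hbal' := hbal
  obtain ⟨hAB, hqA, hqB⟩ := hbal'
  rw [← hn] at hqA hqB
  have hnA : 0 < I.nA := by
    have : n = I.nA + I.nB := rfl
    omega
  have hcoins : I.coins k = coinCount (d n) (k n) := by
    rw [LabelCover.coins, hreg.firstDegree_eq hnA]
  rw [(hP' I).2]
  change (_ → _ ≤ avg _) ∧ (_ → avg _ ≤ _)
  rw [hcoins]
  set j := coinCount (d n) (k n) with hj
  set D : ℝ := (1 / 2) ^ j * d n with hD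
  have hD4 : (d n : ℝ) ^ (1 / (k n : ℝ)) ≤ 4 * D := rpow_le_four_mul_density hd1 hk1
  -- From 18 log n ≤ d^(1/k) ≤ 4 D; this turns the failure probability 20 / D into 5 / log n.
  have hDlog : 4 * Real.logb 2 n ≤ D := by linarith
  have hcard := hreg.card_eq
  have hbad := prob_card_highGirth_le (j := j) (E := I.E) hk1
    (hcard ▸ Nat.le_mul_of_pos_left _ hnA) (fun a => (hreg.1 a).le) (fun b => (hreg.2 b).le)
    (by linarith) (pow_density_le hd1 hk1)
  have hδ1 : 20 / D ≤ 5 / Real.logb 2 n := by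
    rw [div_le_div_iff₀ (by linarith) (by linarith)]
    linarith
  have hpow : (0 : ℝ) < 2 ^ (-(n : ℝ)) := by positivity
  have hE0 : (0 : ℝ) ≤ (1 / 2) ^ j * I.E.card / 8 := by positivity
  have hgirth : ∀ ω : Fin I.nA → Fin I.nB → Fin j → Bool,
      (k n : ℕ∞) < (I.sparsify ω (k n)).supergraph.egirth := fun ω =>
    lt_egirth_highGirth (I.kept ω) (k n)
  have hne : ∀ ω : Fin I.nA → Fin I.nB → Fin j → Bool,
      ¬ ((highGirth (heads I.E ω) (k n)).card : ℝ) ≤ (1 / 2) ^ j * I.E.card / 8 →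
      (I.sparsify ω (k n)).E.Nonempty := by
    intro ω h
    refine Finset.card_pos.1 ?_
    have : (0 : ℝ) < (highGirth (heads I.E ω) (k n)).card := by linarith
    exact_mod_cast this
  constructor
  · intro hsat
    classical
    calc 1 / 2 + ε / 2 ≤ 1 / 2 + ε - prob (fun ω : Fin I.nA → Fin I.nB → Fin j → Bool =>
          ((highGirth (heads I.E ω) (k n)).card : ℝ) ≤ (1 / 2) ^ j * I.E.card / 8) := by
          linarith
      _ = avg fun ω : Fin I.nA → Fin I.nB → Fin j → Bool => (1 / 2 + ε) -
          if ((highGirth (heads I.E ω) (k n)).card : ℝ) ≤ (1 / 2) ^ j * I.E.card / 8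
            then 1 else 0 := by
          rw [avg_sub, avg_const, prob]
      _ ≤ _ := by
          refine avg_mono fun ω => ?_
          split_ifs with h
          · have := P.acceptProb_nonneg (I.sparsify ω (k n)).encode
              (p.eval (I.sparsify ω (k n)).encode.size)
            linarith
          · have := (hP (I.sparsify ω (k n)) hN₀).1
              ⟨hbal, hne ω h, hgirth ω, hsat.sparsify ω (k n)⟩
            linarith
  · intro hval
    classical
    have hbad2 := LabelCover.prob_exists_satisfied_le (I := I) (j := j) (s := s n) (α := α n)
      (by omega) (by omega) hα0
      (by rw [le_div_iff₀ hα0, mul_comm]; exact (le_div_iff₀ hs0).1 hα2.1) hval (by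
        rw [hqA, hcard, ← hn]
        have e1 : (n : ℝ) = 2 * I.nA := by
          have : n = I.nA + I.nB := rfl
          rw [this, ← hAB]; push_cast; ring
        have e2 : α n * Real.logb 2 (σA n) ≤ 4 * D := hA.trans hD4
        -- Since |E| = n d / 2, the exponent 8θ equals 4 n D / α, which is at least n log σ_A.
        have e3 : 8 * ((1 / 2 : ℝ) ^ j * ((I.nA * d n : ℕ) : ℝ) / α n) =
            2 * I.nA * (4 * D / α n) := by
          rw [hD]; push_cast; ring
        rw [e1, e3]
        refine mul_le_mul_of_nonneg_left ?_ (by positivity)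
        rw [le_div_iff₀ hα0, mul_comm]
        exact e2)
    rw [← hn] at hbad2
    set bad : (Fin I.nA → Fin I.nB → Fin j → Bool) → Prop := fun ω =>
      ((highGirth (heads I.E ω) (k n)).card : ℝ) ≤ (1 / 2) ^ j * I.E.card / 8 ∨
      ∃ γ : (Fin I.nA → Fin I.qA) × (Fin I.nB → Fin I.qB),
        18 * ((1 / 2) ^ j * I.E.card / α n) ≤ ((heads (I.satisfied γ.1 γ.2) ω).card : ℝ) with hbd
    have hbad3 : prob bad ≤ ε / 2 := (prob_or_le _ _).trans (by linarith)
    calc _ ≤ avg fun ω : Fin I.nA → Fin I.nB → Fin j → Bool => (1 / 2 - ε) +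
          if bad ω then 1 else 0 := by
          refine avg_mono fun ω => ?_
          split_ifs with h
          · have := P.acceptProb_le_one (I.sparsify ω (k n)).encode
              (p.eval (I.sparsify ω (k n)).encode.size)
            linarith
          · rw [hbd] at h
            push Not at h
            have := (hP (I.sparsify ω (k n)) hN₀).2
              ⟨hbal, hne ω h.1.not_ge, hgirth ω, fun γA γB => ?_⟩
            · linarith
            · have e1 : (((I.sparsify ω (k n)).satisfied γA γB).card : ℝ) ≤
                  (heads (I.satisfied γA γB) ω).card := by
                exact_mod_cast I.card_satisfied_sparsify_le ω (k n) γA γB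
              have e2 := h.2 (γA, γB)
              calc _ ≤ 18 * ((1 / 2) ^ j * I.E.card / α n) := e1.trans e2.le
                _ = 144 / α n * ((1 / 2) ^ j * I.E.card / 8) := by ring
                _ ≤ _ := mul_le_mul_of_nonneg_left h.1.le (by positivity)
      _ = 1 / 2 - ε + prob bad := by
          rw [avg_add, avg_const, prob]
          congr! 3
          congr
      _ ≤ 1 / 2 - ε / 2 := by linarith
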